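/- Let $t_1,\dots,t_m$ be distinct algebraic numbers in $\mathbb{C}$, let $p=(p_j)_{j=1}^m$ be a probability vector, and set $\nu=\sum_{j=1}^m p_j\delta_{t_j}$ and $H(p)=-\sum_{j=1}^m p_j\log p_j$ (with $0\log 0=0$). For $\eta\in\mathbb{C}$ with $0<|\eta|<1$, the Garsia entropy of $\eta$ and $\nu$ is $$h_{\eta,\nu}=\lim_{n\to\infty}\frac1n H\Big(\sum_{j=0}^{n-1}\xi_j\eta^j\Big),$$ where $\xi_0,\xi_1,\dots$ are independent random variables with common law $\nu$ and $H(X)=-\sum_x \mathbb{P}\{X=x\}\log\mathbb{P}\{X=x\}$ is the Shannon entropy of a discrete random variable $X$ (the limit always exists, by subadditivity). The Mahler measure of an algebraic number $\beta$ is $M(\beta)=|a_n|\prod_{i=1}^n\max\{1,|\beta_i|\}$, where $a_n\prod_{i=1}^n(X-\beta_i)\in\mathbb{Z}[X]$ is the minimal polynomial of $\beta$ over $\mathbb{Z}$ with coprime coefficients. Then for every real number $h<H(p)$ there is a positive number $M$, depending only on $h$, $t_1,\dots,t_m$ and $p_1,\dots,p_m$, such that $h_{\eta,\nu}\ge h$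 for every algebraic number $\eta\in\mathbb{C}$ with $0<|\eta|<1$ and $M(\eta)\ge M$. -/

import Mathlib

open MeasureTheory

/-- The atomic measure `∑ j, p j • δ_{t j}` on `ℂ`. -/
noncomputable def atomicMeasure {m : ℕ} (t : Fin m → ℂ) (p : Fin m → ℝ) : Measure ℂ :=
  ∑ j, ENNReal.ofReal (p j) • Measure.dirac (t j)

/-- `H(p) = ∑ j, -p_j log p_j` (with `0 log 0 = 0`). -/
noncomputable def vectorEntropy {m : ℕ} (p : Fin m → ℝ) : ℝ :=
  ∑ j, Real.negMulLog (p j)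

/-- The Shannon entropy `∑ x, -P(X = x) log P(X = x)` of a discrete complex random variable `X`
(used here only for `X` that take finitely many values almost surely). -/
noncomputable def shannonEntropy {Ω : Type*} [MeasurableSpace Ω] (P : Measure Ω) (X : Ω → ℂ) : ℝ :=
  ∑' x : ℂ, Real.negMulLog (P.real (X ⁻¹' {x}))

/-- The Shannon entropy of `∑_{j < n} ξ_j η ^ j`, where `ξ_0, …, ξ_{n-1}` are independent with
common law `ν`; they are realized as the coordinates of the product space `(ℂ ^ n, ν ^ n)`. -/
noncomputable def partialSumEntropy (η : ℂ) (ν : Measure ℂ) (n : ℕ) : ℝ :=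
  shannonEntropy (Measure.pi fun _ : Fin n => ν) fun ξ => ∑ j : Fin n, ξ j * η ^ (j : ℕ)

/-- The Garsia entropy `h_{η,ν} = lim_n H(∑_{j < n} ξ_j η ^ j) / n`. -/
noncomputable def garsiaEntropy (η : ℂ) (ν : Measure ℂ) : ℝ :=
  Filter.limUnder Filter.atTop fun n : ℕ => partialSumEntropy η ν n / n

/-- The minimal polynomial in `ℤ[X]`, with coprime coefficients, of an algebraic number `α`
(unique up to sign): clear the denominators of the minimal polynomial over `ℚ` and divide by the
content. -/
noncomputable def intMinpoly (α : ℂ) : Polynomial ℤ :=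
  (IsLocalization.integerNormalization (nonZeroDivisors ℤ) (minpoly ℚ α)).primPart

/-- The Mahler measure `M(α) = |a_n| ∏ max {1, |α_i|}` of an algebraic number `α`, where `a_n` is
the leading coefficient and the `α_i` are the complex roots of its minimal polynomial in `ℤ[X]`. -/
noncomputable def algMahlerMeasure (α : ℂ) : ℝ :=
  ‖((intMinpoly α).leadingCoeff : ℂ)‖ *
    (((intMinpoly α).map (Int.castRingHom ℂ)).roots.map fun a => max 1 ‖a‖).prod

/-!
A finitely supported probability vector on an abelian group `A` is an element of
`AddMonoidAlgebra ℝ A`, so that the law of a sum of independent variables is a product. Write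
`ent` for the Shannon entropy. The proof compares the partial sums `X n` of `∑ ξ_j η^j`, `ξ_j`
of law `ν`, with an auxiliary noise.

**Entropy inequalities.** The gain `c ↦ ent (a * c) - ent c` is a sum of divergences, so by the
log-sum inequality it decreases when `c` is convolved with a further law (`ent_mul_mul_le`).

**Comparison.** Let `u` be a sum of `k` independent copies of `ξ`, of law `μ = ν ^ k`, and let
`Y N` be the law of `∑ 1 ≤ i ≤ N, u_i η^(-i)`. If `k` is large, `u` hides `ξ`: `ent (ν * μ) -
ent μ ≤ ε` (`exists_pow_hides`). If, on the contrary, `Y N` does not hide `ξ`, in the sense that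
`ent (ν * Y N) ≥ ent (Y N) + h'` for all `N`, then moving one digit at a time from `X n` to the
noise gives `ent (X n) ≥ n (h' - ε)` (`ent_mul_noise_ge`).

**The noise does not hide `ξ`.** It suffices to have an additive functional `Φ` of `ℂ` that
separates the `t_j` and has small variance under `Y N` (`ent_mul_ge_of_var`, by Chebyshev and
Fano). It is found among the combinations of field embeddings `τ` of the algebraic numbers with
a common value `s` on `t`: those send `t_j η^(-i)` to `c_i s_j`, where `c_i` is a combination of
the powers `τ(η)^(-i)`. Subject to `c_0 = 1`, the sum of `|c_i|²` over `i ≥ 1` can be made 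
`P² / (1 - P²)`, where `P` is the product of the `1 / |x|` over the distinct values `x = τ(η)` of
modulus greater than `1`; the optimal `c` comes from a Blaschke product (`exists_powerSum_small`).

**Mahler measure.** There are finitely many `s`, so if the product of the `max 1 |x|` over the
conjugates `x` of `η` is large, then `P` is small for one of them (`exists_embeddings`).
Otherwise the leading coefficient of the integral minimal polynomial is large. Then `η` is a
root of no nonzero polynomial with coefficients in the difference set of `t`
(`exists_leadingCoeff_bound`, by Gauss's lemma applied to the product of the Galois conjugates
of such a polynomial), all the sums `∑ ξ_j η^j` are distinct, and `ent (X n) = n H(p)`.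
-/

namespace Garsia

/-! ### Entropy of finitely supported weights under convolution -/

section Entropy

variable {A : Type*}

/-- The integral `∑ x, a x • F x` of `F` against the finitely supported weight `a`. -/
noncomputable def expect {V : Type*} [AddCommGroup V] [Module ℝ V] (F : A → V)
    (a : AddMonoidAlgebra ℝ A) : V :=
  a.coeff.sum fun x r => r • F x

/-- The total mass of a finitely supported weight. -/
noncomputable def mass (a : AddMonoidAlgebra ℝ A) : ℝ := expect (fun _ => (1 : ℝ)) a

/-- The entropy `∑ x, -a x log (a x)` of a finitely supported weight, which need not be
normalized. -/
noncomputable def ent (a : AddMonoidAlgebra ℝ A) : ℝ :=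
  expect (fun x => -Real.log (a.coeff x)) a

/-- A finitely supported weight with nonnegative values. -/
def IsNonneg (a : AddMonoidAlgebra ℝ A) : Prop := ∀ x, 0 ≤ a.coeff x

section Expect

variable {V : Type*} [AddCommGroup V] [Module ℝ V]

lemma expect_eq_sum (F : A → V) (a : AddMonoidAlgebra ℝ A) {S : Finset A}
    (hS : a.coeff.support ⊆ S) : expect F a = ∑ x ∈ S, a.coeff x • F x :=
  Finsupp.sum_of_support_subset _ hS _ (by simp)

lemma expect_single (F : A → V) (x : A) (r : ℝ) :
    expect F (AddMonoidAlgebra.single x r) = r • F x := by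
  simp [expect]

lemma expect_zero (F : A → V) : expect F (0 : AddMonoidAlgebra ℝ A) = 0 := by
  simp [expect]

lemma expect_add (F : A → V) (a b : AddMonoidAlgebra ℝ A) :
    expect F (a + b) = expect F a + expect F b := by
  classical
  simp only [expect, AddMonoidAlgebra.coeff_add]
  exact Finsupp.sum_add_index' (by simp) (by simp [add_smul])

lemma expect_fun_add (F G : A → V) (a : AddMonoidAlgebra ℝ A) :
    expect (fun x => F x + G x) a = expect F a + expect G a := by
  simp [expect, Finsupp.sum, smul_add, Finset.sum_add_distrib]

lemma expect_const (v : V) (a : AddMonoidAlgebra ℝ A) :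
    expect (fun _ => v) a = mass a • v := by
  simp [expect, mass, Finsupp.sum, Finset.sum_smul]

lemma expect_fun_smul (r : ℝ) (F : A → V) (a : AddMonoidAlgebra ℝ A) :
    expect (fun x => r • F x) a = r • expect F a := by
  simp only [expect, Finsupp.sum, Finset.smul_sum]
  exact Finset.sum_congr rfl fun x _ => smul_comm _ _ _

lemma expect_congr {F G : A → V} {a : AddMonoidAlgebra ℝ A}
    (h : ∀ x ∈ a.coeff.support, F x = G x) : expect F a = expect G a :=
  Finset.sum_congr rfl fun x hx => by simp [h x hx]

lemma expect_mono {F G : A → ℝ} {a : AddMonoidAlgebra ℝ A} (ha : IsNonneg a)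
    (h : ∀ x ∈ a.coeff.support, F x ≤ G x) : expect F a ≤ expect G a :=
  Finset.sum_le_sum fun x hx => mul_le_mul_of_nonneg_left (h x hx) (ha x)

end Expect

lemma mass_single (x : A) (r : ℝ) : mass (AddMonoidAlgebra.single x r) = r := by
  simp [mass, expect_single]

lemma mass_add (a b : AddMonoidAlgebra ℝ A) : mass (a + b) = mass a + mass b :=
  expect_add _ _ _

lemma mass_nonneg {a : AddMonoidAlgebra ℝ A} (ha : IsNonneg a) : 0 ≤ mass a :=
  Finset.sum_nonneg fun x _ => by simpa using ha x

lemma mass_sum {ι : Type*} (s : Finset ι) (f : ι → AddMonoidAlgebra ℝ A) :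
    mass (∑ i ∈ s, f i) = ∑ i ∈ s, mass (f i) := by
  classical
  induction s using Finset.induction_on with
  | empty => simp [mass, expect_zero]
  | insert i s hi ih => rw [Finset.sum_insert hi, Finset.sum_insert hi, mass_add, ih]

lemma coeff_le_mass {a : AddMonoidAlgebra ℝ A} (ha : IsNonneg a) (x : A) :
    a.coeff x ≤ mass a := by
  classical
  rw [mass, expect_eq_sum _ _ (Finset.subset_insert x _)]
  simpa using Finset.single_le_sum (f := fun x => a.coeff x) (fun y _ => ha y)
    (Finset.mem_insert_self x a.coeff.support)

lemma IsNonneg.single (x : A) {r : ℝ} (hr : 0 ≤ r) :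
    IsNonneg (AddMonoidAlgebra.single x r) := fun y => by
  classical
  rw [AddMonoidAlgebra.coeff_single, Finsupp.single_apply]; split_ifs <;> simp [hr]

lemma IsNonneg.add {a b : AddMonoidAlgebra ℝ A} (ha : IsNonneg a) (hb : IsNonneg b) :
    IsNonneg (a + b) := fun x => add_nonneg (ha x) (hb x)

lemma IsNonneg.sum {ι : Type*} {s : Finset ι} {f : ι → AddMonoidAlgebra ℝ A}
    (h : ∀ i ∈ s, IsNonneg (f i)) : IsNonneg (∑ i ∈ s, f i) :=
  Finset.sum_induction f IsNonneg (fun _ _ => .add) (fun x => by simp) h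

/-- The two-term log-sum inequality. -/
lemma log_sum_le {s s' t t' : ℝ} (hs : 0 ≤ s) (hs' : 0 ≤ s') (ht : 0 ≤ t) (ht' : 0 ≤ t')
    (h : 0 < s → 0 < t) (h' : 0 < s' → 0 < t') :
    (s + s') * (Real.log (s + s') - Real.log (t + t')) ≤
      s * (Real.log s - Real.log t) + s' * (Real.log s' - Real.log t') := by
  rcases (add_nonneg hs hs').eq_or_lt with h0 | h0
  · obtain rfl : s = 0 := by linarith
    obtain rfl : s' = 0 := by linarith
    simp
  have hT : 0 < t + t' := by
    rcases hs.eq_or_lt with h1 | h1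
    · have := h' (by linarith); linarith
    · have := h h1; linarith
  -- tangent line of `s log (s / t)` at the common ratio `(s + s') / (t + t')`
  have key : ∀ u v : ℝ, 0 ≤ u → (0 < u → 0 < v) → 0 ≤ v →
      u * (Real.log (s + s') - Real.log (t + t')) + u - v * ((s + s') / (t + t')) ≤
        u * (Real.log u - Real.log v) := by
    intro u v hu huv hv
    rcases hu.eq_or_lt with rfl | hu
    · have : 0 ≤ v * ((s + s') / (t + t')) := by positivity
      simp only [zero_mul, add_zero]; linarith
    have hv := huv hu
    have h1 := Real.log_le_sub_one_of_pos (x := v * ((s + s') / (t + t')) / u) (by positivity)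
    rw [Real.log_div (by positivity) hu.ne', Real.log_mul hv.ne' (by positivity),
      Real.log_div h0.ne' hT.ne'] at h1
    have h2 := mul_le_mul_of_nonneg_left h1 hu.le
    have h3 : u * (v * ((s + s') / (t + t')) / u - 1) = v * ((s + s') / (t + t')) - u := by
      field_simp
    nlinarith
  have k1 := key s t hs h ht
  have k2 := key s' t' hs' h' ht'
  have : t * ((s + s') / (t + t')) + t' * ((s + s') / (t + t')) = s + s' := by
    field_simp
  nlinarith

lemma ent_single (x : A) (r : ℝ) :
    ent (AddMonoidAlgebra.single x r) = Real.negMulLog r := by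
  simp [ent, expect_single, Real.negMulLog]

lemma ent_nonneg {a : AddMonoidAlgebra ℝ A} (ha : IsNonneg a) (ha1 : mass a = 1) : 0 ≤ ent a := by
  refine Finset.sum_nonneg fun x _ => mul_nonneg (ha x) ?_
  exact neg_nonneg.2 (Real.log_nonpos (ha x) (ha1 ▸ coeff_le_mass ha x))

lemma ent_le_log_card {a : AddMonoidAlgebra ℝ A} (ha : IsNonneg a) (ha1 : mass a = 1)
    {S : Finset A} (hS : a.coeff.support ⊆ S) : ent a ≤ Real.log S.card := by
  have h1 : ∑ x ∈ S, a.coeff x = 1 := by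
    rw [← ha1, mass, expect_eq_sum _ _ hS]; simp
  have hne : S.Nonempty := by
    by_contra h0; rw [Finset.not_nonempty_iff_eq_empty] at h0; simp [h0] at h1
  have hN : (0 : ℝ) < S.card := by exact_mod_cast hne.card_pos
  -- termwise `-r log r ≤ r log N + (1 / N - r)`
  have key : ∀ x ∈ S, a.coeff x * -Real.log (a.coeff x) ≤
      a.coeff x * Real.log S.card + ((S.card : ℝ)⁻¹ - a.coeff x) := by
    intro x _
    rcases (ha x).eq_or_lt with h0 | h0
    · rw [← h0]; simp
    have := Real.log_le_sub_one_of_pos (x := ((S.card : ℝ) * a.coeff x)⁻¹) (by positivity)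
    rw [Real.log_inv, Real.log_mul hN.ne' h0.ne'] at this
    have h2 := mul_le_mul_of_nonneg_left this h0.le
    have h3 : a.coeff x * (((S.card : ℝ) * a.coeff x)⁻¹ - 1) = (S.card : ℝ)⁻¹ - a.coeff x := by
      field_simp
    nlinarith
  calc ent a = ∑ x ∈ S, a.coeff x * -Real.log (a.coeff x) := by
        rw [ent, expect_eq_sum _ _ hS]; rfl
    _ ≤ _ := Finset.sum_le_sum key
    _ = Real.log S.card := by
        rw [Finset.sum_add_distrib, Finset.sum_sub_distrib, ← Finset.sum_mul, h1]
        simp [hN.ne']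

variable [AddCommGroup A]

lemma expect_mul {V : Type*} [AddCommGroup V] [Module ℝ V] (F : A → V)
    (a b : AddMonoidAlgebra ℝ A) :
    expect F (a * b) = expect (fun x => expect (fun y => F (x + y)) b) a := by
  induction a using AddMonoidAlgebra.induction_linear with
  | zero => simp [expect_zero]
  | add a a' h h' => rw [add_mul, expect_add, expect_add, h, h']
  | single x r =>
    induction b using AddMonoidAlgebra.induction_linear with
    | zero => simp [expect_zero, expect_single]
    | add b b' h h' => simp only [mul_add, expect_add, expect_single, smul_add] at *; rw [h, h']
    | single y s => simp [AddMonoidAlgebra.single_mul_single, expect_single, mul_smul]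

lemma mass_one : mass (1 : AddMonoidAlgebra ℝ A) = 1 := by
  rw [AddMonoidAlgebra.one_def, mass_single]

lemma mass_mul (a b : AddMonoidAlgebra ℝ A) : mass (a * b) = mass a * mass b := by
  simp only [mass, expect_mul]
  rw [expect_const]; simp [mass]

lemma IsNonneg.one : IsNonneg (1 : AddMonoidAlgebra ℝ A) := .single 0 zero_le_one

lemma coeff_mul_eq_expect (a b : AddMonoidAlgebra ℝ A) (w : A) :
    (a * b).coeff w = expect (fun x => b.coeff (-x + w)) a := by
  rw [AddMonoidAlgebra.coeff_mul_apply_left]; rfl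

lemma IsNonneg.mul {a b : AddMonoidAlgebra ℝ A} (ha : IsNonneg a) (hb : IsNonneg b) :
    IsNonneg (a * b) := fun w => by
  rw [coeff_mul_eq_expect]
  exact Finset.sum_nonneg fun x _ => mul_nonneg (ha x) (hb _)

lemma IsNonneg.prod {ι : Type*} {s : Finset ι} {f : ι → AddMonoidAlgebra ℝ A}
    (h : ∀ i ∈ s, IsNonneg (f i)) : IsNonneg (∏ i ∈ s, f i) :=
  Finset.prod_induction f IsNonneg (fun _ _ => .mul) .one h

lemma IsNonneg.pow {a : AddMonoidAlgebra ℝ A} (ha : IsNonneg a) (k : ℕ) : IsNonneg (a ^ k) := by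
  rw [← Finset.card_range k, ← Finset.prod_const]; exact .prod fun _ _ => ha

lemma mul_coeff_le_coeff_mul {a b : AddMonoidAlgebra ℝ A} (ha : IsNonneg a) (hb : IsNonneg b)
    (x y : A) : a.coeff x * b.coeff y ≤ (a * b).coeff (x + y) := by
  classical
  rw [coeff_mul_eq_expect, expect_eq_sum _ _ (Finset.subset_insert x _)]
  simpa using Finset.single_le_sum (f := fun z => a.coeff z * b.coeff (-z + (x + y)))
    (fun z _ => mul_nonneg (ha z) (hb _)) (Finset.mem_insert_self x a.coeff.support)

/-- A functional on weights that is homogeneous, translation invariant and subadditive is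
nonincreasing under convolution with a probability vector. -/
lemma apply_mul_le {Ψ : AddMonoidAlgebra ℝ A → ℝ}
    (hsingle : ∀ (x : A) (r : ℝ) (c : AddMonoidAlgebra ℝ A), 0 ≤ r → IsNonneg c →
      Ψ (AddMonoidAlgebra.single x r * c) = r * Ψ c)
    (hadd : ∀ c c' : AddMonoidAlgebra ℝ A, IsNonneg c → IsNonneg c' → Ψ (c + c') ≤ Ψ c + Ψ c')
    {b c : AddMonoidAlgebra ℝ A} (hb : IsNonneg b) (hc : IsNonneg c) :
    Ψ (b * c) ≤ mass b * Ψ c := by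
  classical
  have key : ∀ s : Finset A, Ψ ((∑ x ∈ s, AddMonoidAlgebra.single x (b.coeff x)) * c) ≤
      (∑ x ∈ s, b.coeff x) * Ψ c := by
    intro s
    induction s using Finset.induction_on with
    | empty => simpa using (hsingle 0 0 c le_rfl hc).le
    | insert x s hx ih =>
      rw [Finset.sum_insert hx, Finset.sum_insert hx, add_mul, add_mul,
        ← hsingle x _ c (hb x) hc]
      refine (hadd _ _ ((IsNonneg.single x (hb x)).mul hc) (IsNonneg.mul (.sum ?_) hc)).trans
        (by linarith)
      exact fun y _ => .single y (hb y)
  have h1 : ∑ x ∈ b.coeff.support, AddMonoidAlgebra.single x (b.coeff x) = b :=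
    AddMonoidAlgebra.sum_coeff_single b
  have h2 : ∑ x ∈ b.coeff.support, b.coeff x = mass b := by simp [mass, expect, Finsupp.sum]
  have := key b.coeff.support
  rwa [h1, h2] at this

/-- The entropy of a convolution product all of whose sums are distinct. -/
lemma ent_mul_of_unique {a b : AddMonoidAlgebra ℝ A}
    (h : ∀ x ∈ a.coeff.support, ∀ x' ∈ a.coeff.support, ∀ y ∈ b.coeff.support,
      ∀ y' ∈ b.coeff.support, x + y = x' + y' → x = x') :
    ent (a * b) = mass b * ent a + mass a * ent b := by
  classical
  have hc : ∀ x ∈ a.coeff.support, ∀ y ∈ b.coeff.support,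
      (a * b).coeff (x + y) = a.coeff x * b.coeff y := by
    intro x hx y hy
    rw [coeff_mul_eq_expect, expect, Finsupp.sum, Finset.sum_eq_single x]
    · simp
    · intro x' hx' hne
      by_contra h0
      refine hne (h x' hx' x hx (-x' + (x + y)) ?_ y hy (by abel))
      rw [Finsupp.mem_support_iff]
      exact fun h1 => h0 (by simp [h1])
    · intro h0; exact absurd hx h0
  rw [ent, expect_mul]
  have : ∀ x ∈ a.coeff.support,
      expect (fun y => -Real.log ((a * b).coeff (x + y))) b =
        mass b * -Real.log (a.coeff x) + ent b := by
    intro x hx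
    rw [expect_congr (G := fun y => -Real.log (a.coeff x) + -Real.log (b.coeff y)),
      expect_fun_add, expect_const]
    · rfl
    · intro y hy
      rw [hc x hx y hy, Real.log_mul (Finsupp.mem_support_iff.1 hx) (Finsupp.mem_support_iff.1 hy)]
      ring
  rw [expect_congr this, expect_fun_add, expect_const]
  have h2 := expect_fun_smul (mass b) (fun x => -Real.log (a.coeff x)) a
  simp only [smul_eq_mul] at h2 ⊢
  rw [h2]; rfl

lemma ent_one : ent (1 : AddMonoidAlgebra ℝ A) = 0 := by
  simp [AddMonoidAlgebra.one_def, ent_single]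

lemma ent_single_mul (x : A) (r : ℝ) (c : AddMonoidAlgebra ℝ A) :
    ent (AddMonoidAlgebra.single x r * c) = mass c * Real.negMulLog r + r * ent c := by
  rw [ent_mul_of_unique, ent_single, mass_single]
  intro y hy y' hy' _ _ _ _ _
  have := Finsupp.support_single_subset hy
  have := Finsupp.support_single_subset hy'
  simp_all

/-- The entropy gained by adding `a`, as a sum over `x` of divergences of `c` from the
`x`-translate of `a * c`. -/
lemma ent_mul_sub_eq (a c : AddMonoidAlgebra ℝ A) {S T : Finset A} (hS : a.coeff.support ⊆ S)
    (hT : c.coeff.support ⊆ T) :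
    ent (a * c) - mass a * ent c = ∑ x ∈ S, a.coeff x * ∑ z ∈ T,
      c.coeff z * (Real.log (c.coeff z) - Real.log ((a * c).coeff (x + z))) := by
  rw [ent, expect_mul, expect_eq_sum _ _ hS, mass, expect_eq_sum _ _ hS, ent,
    expect_eq_sum _ _ hT, Finset.sum_mul, ← Finset.sum_sub_distrib]
  refine Finset.sum_congr rfl fun x _ => ?_
  rw [expect_eq_sum _ _ hT]
  simp only [smul_eq_mul, mul_one]
  rw [← mul_sub, ← Finset.sum_sub_distrib]
  congr 1
  exact Finset.sum_congr rfl fun z _ => by ring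

/-- Submodularity of the entropy of sums: smoothing by `b` decreases the entropy gained from
adding `a`. The gain is a sum of relative entropies, hence subadditive in `c`. -/
lemma ent_mul_mul_le {a b c : AddMonoidAlgebra ℝ A} (ha : IsNonneg a) (hb : IsNonneg b)
    (hc : IsNonneg c) (hb1 : mass b = 1) :
    ent (a * (b * c)) - mass a * ent (b * c) ≤ ent (a * c) - mass a * ent c := by
  classical
  have := apply_mul_le (Ψ := fun c => ent (a * c) - mass a * ent c) ?_ ?_ hb hc
  · simpa [hb1] using this
  · intro x r c _ _
    rw [mul_left_comm, ent_single_mul, ent_single_mul, mass_mul]; ring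
  · intro c c' hc hc'
    rw [ent_mul_sub_eq a (c + c') subset_rfl (T := c.coeff.support ∪ c'.coeff.support)
        Finsupp.support_add,
      ent_mul_sub_eq a c subset_rfl Finset.subset_union_left,
      ent_mul_sub_eq a c' subset_rfl Finset.subset_union_right, ← Finset.sum_add_distrib]
    refine Finset.sum_le_sum fun x hx => ?_
    rw [← mul_add, ← Finset.sum_add_distrib]
    refine mul_le_mul_of_nonneg_left (Finset.sum_le_sum fun z _ => ?_) (ha x)
    have hx0 : 0 < a.coeff x := (ha x).lt_of_ne' (Finsupp.mem_support_iff.1 hx)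
    rw [mul_add]
    refine log_sum_le (hc z) (hc' z) (ha.mul hc _) (ha.mul hc' _) (fun h => ?_) (fun h => ?_)
    · exact (mul_pos hx0 h).trans_le (mul_coeff_le_coeff_mul ha hc x z)
    · exact (mul_pos hx0 h).trans_le (mul_coeff_le_coeff_mul ha hc' x z)

lemma ent_mul_le {a b : AddMonoidAlgebra ℝ A} (ha : IsNonneg a) (hb : IsNonneg b)
    (ha1 : mass a = 1) (hb1 : mass b = 1) : ent (a * b) ≤ ent a + ent b := by
  have := ent_mul_mul_le ha hb .one hb1
  simp only [mul_one, ent_one, ha1] at this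
  linarith

/-- Concavity of entropy, for weights that are not normalized. -/
lemma ent_add_ge {c c' : AddMonoidAlgebra ℝ A} (hc : IsNonneg c) (hc' : IsNonneg c') :
    (ent c - Real.negMulLog (mass c)) + (ent c' - Real.negMulLog (mass c')) ≤
      ent (c + c') - Real.negMulLog (mass (c + c')) := by
  classical
  have key : ∀ (d : AddMonoidAlgebra ℝ A) (T : Finset A), d.coeff.support ⊆ T →
      ent d - Real.negMulLog (mass d) =
        -∑ z ∈ T, d.coeff z * (Real.log (d.coeff z) - Real.log (mass d)) := by
    intro d T hT
    have h1 : mass d = ∑ z ∈ T, d.coeff z := by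
      rw [mass, expect_eq_sum _ _ hT]; simp
    simp only [mul_sub, Finset.sum_sub_distrib, ← Finset.sum_mul, ← h1]
    rw [ent, expect_eq_sum _ _ hT, Real.negMulLog]
    simp only [smul_eq_mul, mul_neg, Finset.sum_neg_distrib]
    ring
  rw [key c _ Finset.subset_union_left, key c' _ Finset.subset_union_right,
    key (c + c') (c.coeff.support ∪ c'.coeff.support) Finsupp.support_add, ← neg_add,
    neg_le_neg_iff,
    ← Finset.sum_add_distrib]
  refine Finset.sum_le_sum fun z _ => ?_
  rw [mass_add]
  exact log_sum_le (hc z) (hc' z) (mass_nonneg hc) (mass_nonneg hc')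
    (fun h => h.trans_le (coeff_le_mass hc z)) (fun h => h.trans_le (coeff_le_mass hc' z))

/-- Adding an independent variable does not decrease entropy. -/
lemma ent_le_ent_mul {b c : AddMonoidAlgebra ℝ A} (hb : IsNonneg b) (hc : IsNonneg c)
    (hb1 : mass b = 1) : ent c ≤ ent (b * c) := by
  have := apply_mul_le (Ψ := fun c => -(ent c - Real.negMulLog (mass c))) ?_ ?_ hb hc
  · simp only [hb1, mass_mul, one_mul] at this; linarith
  · intro x r c _ _
    rw [ent_single_mul, mass_mul, mass_single, Real.negMulLog_mul]; ring
  · intro c c' hc hc'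
    have := ent_add_ge hc hc'
    linarith

/-- If `y = g + b` with disjoint supports and the `ν`-part can be read off from the sum on the part
`g`, then adding `ν` gains almost all of its entropy: a form of Fano's inequality. -/
lemma ent_mul_ge_of_unique {ν g b : AddMonoidAlgebra ℝ A} (hν : IsNonneg ν) (hg : IsNonneg g)
    (hb : IsNonneg b) (hν1 : mass ν = 1) (hgb : mass g + mass b = 1)
    (hdisj : Disjoint g.coeff.support b.coeff.support)
    (h : ∀ x ∈ ν.coeff.support, ∀ x' ∈ ν.coeff.support, ∀ y ∈ g.coeff.support,
      ∀ y' ∈ g.coeff.support, x + y = x' + y' → x = x') :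
    ent (g + b) + mass g * ent ν - Real.binEntropy (mass b) ≤ ent (ν * (g + b)) := by
  classical
  have h1 := ent_add_ge (hν.mul hg) (hν.mul hb)
  have h2 := ent_mul_of_unique h
  have h3 := ent_le_ent_mul hν hb hν1
  have h4 : ent (g + b) = ent g + ent b := by
    rw [ent, ent, ent, expect_add]
    congr 1
    · refine expect_congr fun x hx => ?_
      have := Finset.disjoint_left.1 hdisj hx
      rw [AddMonoidAlgebra.coeff_add, Finsupp.add_apply, Finsupp.notMem_support_iff.1 this,
        add_zero]
    · refine expect_congr fun x hx => ?_
      have := Finset.disjoint_right.1 hdisj hx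
      rw [AddMonoidAlgebra.coeff_add, Finsupp.add_apply, Finsupp.notMem_support_iff.1 this,
        zero_add]
  rw [← mul_add] at h1
  simp only [mass_mul, mass_add, hν1, one_mul, hgb, Real.negMulLog_one] at h1 h2
  rw [Real.binEntropy_eq_negMulLog_add_negMulLog_one_sub, ← eq_sub_of_add_eq hgb]
  linarith

end Entropy

/-! ### Images under homomorphisms and the comparison with a noise -/

section Pushforward

variable {A B : Type*} [AddCommGroup A] [AddCommGroup B]

lemma expect_map {V : Type*} [AddCommGroup V] [Module ℝ V] (F : B → V) (f : A →+ B)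
    (a : AddMonoidAlgebra ℝ A) :
    expect F (AddMonoidAlgebra.mapDomainRingHom ℝ f a) = expect (fun x => F (f x)) a := by
  induction a using AddMonoidAlgebra.induction_linear with
  | zero => simp [expect_zero]
  | add a a' h h' => rw [map_add, expect_add, expect_add, h, h']
  | single x r => simp [expect_single]

lemma mass_map (f : A →+ B) (a : AddMonoidAlgebra ℝ A) :
    mass (AddMonoidAlgebra.mapDomainRingHom ℝ f a) = mass a := expect_map _ _ _

lemma IsNonneg.map (f : A →+ B) {a : AddMonoidAlgebra ℝ A} (ha : IsNonneg a) :
    IsNonneg (AddMonoidAlgebra.mapDomainRingHom ℝ f a) := by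
  rw [← AddMonoidAlgebra.sum_coeff_single a, Finsupp.sum, map_sum]
  refine .sum fun x _ => ?_
  simpa using .single _ (ha x)

lemma ent_map {f : A →+ B} (hf : Function.Injective f) (a : AddMonoidAlgebra ℝ A) :
    ent (AddMonoidAlgebra.mapDomainRingHom ℝ f a) = ent a := by
  rw [ent, expect_map]
  refine expect_congr fun x _ => ?_
  simp [AddMonoidAlgebra.mapDomain, Finsupp.mapDomain_apply hf]

/-- Lower bound for the entropy of the law `X n` of `∑ j < n, f^j ξ_j`, where `ξ_j` has law `ν`, by
comparison with an auxiliary noise of law `Y N`, which is to be thought of as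
`∑ 1 ≤ j ≤ N, f^(-j) u_j` with `u_j` of law `μ`. It suffices that the noise does not hide `ν`
(constant `h'`), while a single digit `μ` of it does (constant `ε`). -/
lemma ent_mul_noise_ge {f : A →+ A} (hf : Function.Injective f) {ν μ : AddMonoidAlgebra ℝ A}
    (hν : IsNonneg ν) (hν1 : mass ν = 1) (hμ : IsNonneg μ) (hμ1 : mass μ = 1)
    {X Y : ℕ → AddMonoidAlgebra ℝ A} (hX0 : X 0 = 1)
    (hX : ∀ n, X (n + 1) = ν * AddMonoidAlgebra.mapDomainRingHom ℝ f (X n))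
    (hXp : ∀ n, IsNonneg (X n)) (hX1 : ∀ n, mass (X n) = 1)
    (hY : ∀ n, AddMonoidAlgebra.mapDomainRingHom ℝ f (Y (n + 1)) = μ * Y n)
    (hYp : ∀ n, IsNonneg (Y n)) (hY1 : ∀ n, mass (Y n) = 1) {h' ε : ℝ}
    (hsee : ∀ n, ent (Y n) + h' ≤ ent (ν * Y n)) (hhide : ent (ν * μ) - ent μ ≤ ε) (n N : ℕ) :
    n * (h' - ε) + ent (Y N) ≤ ent (X n * Y N) := by
  induction n generalizing N with
  | zero => simp [hX0]
  | succ n ih =>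
    set D := AddMonoidAlgebra.mapDomainRingHom ℝ f
    have hDX : IsNonneg (D (X n)) := (hXp n).map f
    have hDX1 : mass (D (X n)) = 1 := (mass_map _ _).trans (hX1 n)
    have e1 : ent (X n * Y (N + 1)) = ent (μ * (D (X n) * Y N)) := by
      rw [← ent_map hf]
      change ent (D _) = _
      rw [map_mul, hY, mul_left_comm]
    have i1 := ent_le_ent_mul hν (hμ.mul (hDX.mul (hYp N))) hν1
    have i2 := ent_mul_mul_le hμ hDX (hν.mul (hYp N)) hDX1
    have i3 := ent_mul_mul_le hν (hYp N) hμ (hY1 N)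
    have e2 : ent (Y N * μ) = ent (Y (N + 1)) := by
      rw [mul_comm, ← hY, ent_map hf]
    have e3 : ν * (μ * (D (X n) * Y N)) = μ * (D (X n) * (ν * Y N)) := by ring
    have e4 : X (n + 1) * Y N = D (X n) * (ν * Y N) := by rw [hX]; ring
    have e5 : ν * (Y N * μ) = μ * (ν * Y N) := by ring
    rw [e3] at i1
    rw [e5, e2, hν1] at i3
    rw [hμ1] at i2
    rw [e4]
    have := ih (N + 1)
    have := hsee N
    rw [e1] at *
    push_cast
    linarith

end Pushforward

/-! ### Blaschke products and power sums of small norm -/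

section Blaschke

open ComplexConjugate

/-- The Blaschke product `∏ (z - conj b) / (1 - b z)` of a finite set of distinct `b` with
`0 < |b| < 1`: its partial fraction coefficients `β`, `a`, and the bound by `1` on the `ℓ²` norm of
its Taylor coefficients. -/
lemma exists_blaschke (S : Finset ℂ) (hS : ∀ b ∈ S, b ≠ 0 ∧ ‖b‖ < 1) :
    ∃ (a : ℂ → ℂ) (β : ℂ), β * ∏ b ∈ S, (-b) = 1 ∧ β + ∑ x ∈ S, a x = ∏ b ∈ S, (-conj b) ∧
      ∀ N : ℕ, ‖∏ b ∈ S, (-conj b)‖ ^ 2 +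
        ∑ j ∈ Finset.range N, ‖∑ x ∈ S, a x * x ^ (j + 1)‖ ^ 2 ≤ 1 := by
  classical
  induction S using Finset.induction_on with
  | empty => exact ⟨0, 1, by simp⟩
  | insert b S hbS ih =>
    obtain ⟨a, β, hβ, hsum, hle⟩ := ih fun x hx => hS x (Finset.mem_insert_of_mem hx)
    obtain ⟨hb0, hb1⟩ := hS b (Finset.mem_insert_self b S)
    have hne : ∀ x ∈ S, x - b ≠ 0 := fun x hx h =>
      hbS (by rwa [← sub_eq_zero.1 h])
    have hx0 : ∀ x ∈ S, x ≠ 0 := fun x hx => (hS x (Finset.mem_insert_of_mem hx)).1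
    -- `w` is the Taylor sequence of the previous product divided by `1 - b z`
    set a' : ℂ → ℂ := fun x =>
      if x = b then β - ∑ y ∈ S, a y * b / (y - b) else a x * x / (x - b) with ha'
    have hab : a' b = β - ∑ y ∈ S, a y * b / (y - b) := by simp [ha']
    have hax : ∀ x ∈ S, a' x = a x * x / (x - b) := fun x hx => by
      have : x ≠ b := fun h => hbS (h ▸ hx)
      simp [ha', this]
    set w : ℕ → ℂ := fun j => ∑ x ∈ insert b S, a' x * x ^ j with hw
    have hw0 : w 0 = ∏ b ∈ S, (-conj b) := by
      rw [← hsum]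
      simp only [hw, Finset.sum_insert hbS, pow_zero, mul_one, hab]
      rw [Finset.sum_congr rfl hax, sub_add, ← Finset.sum_sub_distrib, sub_eq_add_neg,
        ← Finset.sum_neg_distrib]
      congr 1
      refine Finset.sum_congr rfl fun x hx => ?_
      have := hne x hx
      field_simp
      ring
    have hf : ∀ j, ∑ x ∈ S, a x * x ^ (j + 1) = w (j + 1) - b * w j := by
      intro j
      simp only [hw, Finset.sum_insert hbS, mul_add, Finset.mul_sum]
      rw [add_sub_add_comm, ← Finset.sum_sub_distrib,
        show a' b * b ^ (j + 1) - b * (a' b * b ^ j) = 0 by ring, zero_add]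
      refine Finset.sum_congr rfl fun x hx => ?_
      have := hne x hx
      rw [hax x hx]
      field_simp
      ring
    set a'' : ℂ → ℂ := fun x => a' x * (1 / x - conj b) with ha''
    have hx0' : ∀ x ∈ insert b S, x ≠ 0 := fun x hx => (hS x hx).1
    have hg : ∀ j, ∑ x ∈ insert b S, a'' x * x ^ (j + 1) = w j - conj b * w (j + 1) := by
      intro j
      simp only [hw, Finset.mul_sum]
      rw [← Finset.sum_sub_distrib]
      refine Finset.sum_congr rfl fun x hx => ?_
      have := hx0' x hx
      simp only [ha'']
      field_simp
      ring
    refine ⟨a'', -β / b, ?_, ?_, fun N => ?_⟩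
    · rw [Finset.prod_insert hbS, ← hβ]
      field_simp
    · have h1 : ∑ x ∈ insert b S, a'' x = ∑ x ∈ insert b S, a' x / x - conj b * w 0 := by
        simp only [hw, Finset.mul_sum]
        rw [← Finset.sum_sub_distrib]
        refine Finset.sum_congr rfl fun x hx => ?_
        simp only [ha'', pow_zero]
        ring
      have h2 : ∑ x ∈ insert b S, a' x / x = β / b := by
        rw [Finset.sum_insert hbS, hab, sub_div, Finset.sum_div, sub_add, sub_eq_self, sub_eq_zero]
        refine Finset.sum_congr rfl fun x hx => ?_
        have := hne x hx
        have := hx0 x hx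
        rw [hax x hx]
        field_simp
      rw [h1, h2, hw0, Finset.prod_insert hbS]
      ring
    · -- `|w_{j+1} - b w_j|² - |w_j - conj b w_{j+1}|²` telescopes
      have hid : ∀ u v : ℂ, ‖v - b * u‖ ^ 2 - ‖u - conj b * v‖ ^ 2 =
          (1 - ‖b‖ ^ 2) * (‖v‖ ^ 2 - ‖u‖ ^ 2) := by
        intro u v
        simp only [Complex.sq_norm, Complex.normSq_apply, Complex.sub_re, Complex.sub_im,
          Complex.mul_re, Complex.mul_im, Complex.conj_re, Complex.conj_im]
        ring
      have htel : ∀ N : ℕ, ‖w 0‖ ^ 2 + ∑ j ∈ Finset.range N, ‖w (j + 1) - b * w j‖ ^ 2 =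
          ‖conj b * w 0‖ ^ 2 + ∑ j ∈ Finset.range N, ‖w j - conj b * w (j + 1)‖ ^ 2 +
            (1 - ‖b‖ ^ 2) * ‖w N‖ ^ 2 := by
        intro N
        induction N with
        | zero => simp only [Finset.range_zero, Finset.sum_empty, norm_mul, RCLike.norm_conj]; ring
        | succ N ih =>
          rw [Finset.sum_range_succ, Finset.sum_range_succ]
          have := hid (w N) (w (N + 1))
          linarith
      have h1 := hle N
      simp only [hf, hg] at h1 ⊢
      rw [Finset.prod_insert hbS, ← hw0, neg_mul, norm_neg]
      rw [← hw0] at h1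
      have h2 : 0 ≤ (1 - ‖b‖ ^ 2) * ‖w N‖ ^ 2 := by
        have : ‖b‖ ^ 2 ≤ 1 := pow_le_one₀ (norm_nonneg _) hb1.le
        exact mul_nonneg (by linarith) (by positivity)
      linarith [htel N]

/-- A power sum `j ↦ ∑ a_x x ^ j` with value `1` at `0` and small `ℓ²` norm elsewhere: up to
normalization, the Taylor coefficients of `1 - conj (B 0) * B` for the Blaschke product `B`. -/
lemma exists_powerSum_small (S : Finset ℂ) (hS : ∀ b ∈ S, b ≠ 0 ∧ ‖b‖ < 1)
    (hP : ∏ b ∈ S, ‖b‖ < 1) :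
    ∃ a : ℂ → ℂ, ∑ x ∈ S, a x = 1 ∧ ∀ N : ℕ,
      ∑ j ∈ Finset.range N, ‖∑ x ∈ S, a x * x ^ (j + 1)‖ ^ 2 ≤
        (∏ b ∈ S, ‖b‖) ^ 2 / (1 - (∏ b ∈ S, ‖b‖) ^ 2) := by
  obtain ⟨a, β, hβ, hsum, hle⟩ := exists_blaschke S hS
  set P := ∏ b ∈ S, ‖b‖ with hPdef
  have hP0 : 0 ≤ P := Finset.prod_nonneg fun _ _ => norm_nonneg _
  set C : ℂ := ∏ b ∈ S, (-b) with hC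
  have hCc : ∏ b ∈ S, (-conj b) = conj C := by simp [hC, map_prod]
  have hCn : ‖C‖ = P := by simp [hC, hPdef]
  have hCm : C * conj C = (P : ℂ) ^ 2 := by
    rw [Complex.mul_conj, Complex.normSq_eq_norm_sq, hCn]; push_cast; rfl
  have hpos : 0 < 1 - P ^ 2 := by nlinarith
  have hne : (1 - (P : ℂ) ^ 2) ≠ 0 := by exact_mod_cast hpos.ne'
  refine ⟨fun x => -C / (1 - (P : ℂ) ^ 2) * a x, ?_, fun N => ?_⟩
  · rw [← Finset.mul_sum, eq_sub_of_add_eq' hsum, hCc]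
    field_simp
    linear_combination hβ - hCm
  · have h1 := hle N
    rw [hCc, RCLike.norm_conj, hCn] at h1
    have h2 : ‖-C / (1 - (P : ℂ) ^ 2)‖ ^ 2 = P ^ 2 / (1 - P ^ 2) ^ 2 := by
      rw [norm_div, norm_neg, hCn, div_pow]
      congr 2
      rw [show (1 - (P : ℂ) ^ 2) = ((1 - P ^ 2 : ℝ) : ℂ) by push_cast; rfl, Complex.norm_real,
        Real.norm_of_nonneg hpos.le]
    simp only [mul_assoc, ← Finset.mul_sum, norm_mul, mul_pow, h2]
    calc _ ≤ P ^ 2 / (1 - P ^ 2) ^ 2 * (1 - P ^ 2) := by gcongr; linarith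
      _ = _ := by field_simp

end Blaschke

/-! ### Variance, and recovery of a summand by Chebyshev and Fano -/

section Variance

open scoped InnerProductSpace

variable {A B : Type*}

/-- The variance of the complex-valued function `f` under the weight `a`. -/
noncomputable def var (f : A → ℂ) (a : AddMonoidAlgebra ℝ A) : ℝ :=
  expect (fun x => ‖f x - expect f a‖ ^ 2) a

lemma expect_inner (u : ℂ) (F : A → ℂ) (a : AddMonoidAlgebra ℝ A) :
    expect (fun x => ⟪u, F x⟫_ℝ) a = ⟪u, expect F a⟫_ℝ := by
  simp only [expect, Finsupp.sum, inner_sum, real_inner_smul_right, smul_eq_mul]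

lemma var_eq (f : A → ℂ) {a : AddMonoidAlgebra ℝ A} (ha : mass a = 1) :
    var f a = expect (fun x => ‖f x‖ ^ 2) a - ‖expect f a‖ ^ 2 := by
  have : ∀ x, ‖f x - expect f a‖ ^ 2 =
      ‖f x‖ ^ 2 + ((-2 : ℝ) • ⟪expect f a, f x⟫_ℝ + ‖expect f a‖ ^ 2) := fun x => by
    rw [norm_sub_sq_real, real_inner_comm, smul_eq_mul]; ring
  simp only [var, this]
  rw [expect_fun_add, expect_fun_add, expect_fun_smul, expect_inner, expect_const, ha,
    real_inner_self_eq_norm_sq]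
  simp only [smul_eq_mul]
  ring

lemma var_le_sq {f : A → ℂ} {a : AddMonoidAlgebra ℝ A} (ha : IsNonneg a) (ha1 : mass a = 1)
    {R : ℝ} (hR : ∀ x ∈ a.coeff.support, ‖f x‖ ≤ R) : var f a ≤ R ^ 2 := by
  rw [var_eq _ ha1]
  have : expect (fun x => ‖f x‖ ^ 2) a ≤ expect (fun _ => R ^ 2) a :=
    expect_mono ha fun x hx => pow_le_pow_left₀ (norm_nonneg _) (hR x hx) 2
  rw [expect_const, ha1, one_smul] at this
  have := sq_nonneg ‖expect f a‖
  linarith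

variable [AddCommGroup A] [AddCommGroup B]

lemma var_mul (f : A →+ ℂ) {a b : AddMonoidAlgebra ℝ A} (ha : mass a = 1) (hb : mass b = 1) :
    var f (a * b) = var f a + var f b := by
  have hE : expect f (a * b) = expect f a + expect f b := by
    simp only [expect_mul, map_add, expect_fun_add, expect_const, ha, hb, one_smul]
  have hE2 : expect (fun x => ‖f x‖ ^ 2) (a * b) = expect (fun x => ‖f x‖ ^ 2) a +
      (2 * ⟪expect f a, expect f b⟫_ℝ + expect (fun x => ‖f x‖ ^ 2) b) := by
    have : ∀ x y, ‖f (x + y)‖ ^ 2 = ‖f x‖ ^ 2 + ((2 : ℝ) • ⟪f x, f y⟫_ℝ + ‖f y‖ ^ 2) :=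
      fun x y => by rw [map_add, norm_add_sq_real, smul_eq_mul]; ring
    simp only [expect_mul, this, expect_fun_add, expect_const, expect_fun_smul, expect_inner, ha,
      hb, one_smul, real_inner_comm (expect f b)]
    simp [real_inner_comm]
  rw [var_eq _ (by rw [mass_mul, ha, hb, one_mul]), var_eq _ ha, var_eq _ hb, hE, hE2,
    norm_add_sq_real]
  ring

lemma var_one (f : A →+ ℂ) : var f (1 : AddMonoidAlgebra ℝ A) = 0 := by
  rw [var_eq _ mass_one]; simp [AddMonoidAlgebra.one_def, expect_single]

lemma mass_prod_eq_one {ι : Type*} {s : Finset ι} {a : ι → AddMonoidAlgebra ℝ A}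
    (ha : ∀ i ∈ s, mass (a i) = 1) : mass (∏ i ∈ s, a i) = 1 :=
  Finset.prod_induction a (fun b => mass b = 1)
    (fun b c hb hc => by rw [mass_mul, hb, hc, one_mul]) mass_one ha

lemma mass_pow_eq_one {a : AddMonoidAlgebra ℝ A} (ha : mass a = 1) (k : ℕ) : mass (a ^ k) = 1 := by
  rw [← Finset.card_range k, ← Finset.prod_const]; exact mass_prod_eq_one fun _ _ => ha

lemma var_prod (f : A →+ ℂ) {ι : Type*} {s : Finset ι} {a : ι → AddMonoidAlgebra ℝ A}
    (ha : ∀ i ∈ s, mass (a i) = 1) : var f (∏ i ∈ s, a i) = ∑ i ∈ s, var f (a i) := by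
  classical
  induction s using Finset.induction_on with
  | empty => simp [var_one]
  | insert i s hi ih =>
    have hs : ∀ j ∈ s, mass (a j) = 1 := fun j hj => ha j (Finset.mem_insert_of_mem hj)
    rw [Finset.prod_insert hi, Finset.sum_insert hi,
      var_mul f (ha i (Finset.mem_insert_self i s)) (mass_prod_eq_one hs), ih hs]

lemma var_pow (f : A →+ ℂ) {a : AddMonoidAlgebra ℝ A} (ha : mass a = 1) (k : ℕ) :
    var f (a ^ k) = k * var f a := by
  rw [← Finset.card_range k, ← Finset.prod_const, var_prod f fun _ _ => ha, Finset.sum_const,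
    nsmul_eq_mul]

lemma var_map (f : B → ℂ) (g : A →+ B) (a : AddMonoidAlgebra ℝ A) :
    var f (AddMonoidAlgebra.mapDomainRingHom ℝ g a) = var (fun x => f (g x)) a := by
  simp only [var, expect_map]

/-- If an additive function `f` separates the atoms of `ν` and has small variance under the noise
`y`, then little of the entropy of `ν` is lost in the noise (Chebyshev and Fano). -/
lemma ent_mul_ge_of_var {ν y : AddMonoidAlgebra ℝ A} (hν : IsNonneg ν) (hν1 : mass ν = 1)
    (hy : IsNonneg y) (hy1 : mass y = 1) (f : A →+ ℂ) {δ : ℝ} (hδ : 0 < δ)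
    (hsep : ∀ x ∈ ν.coeff.support, ∀ x' ∈ ν.coeff.support, x ≠ x' → δ ≤ ‖f x - f x'‖) :
    ∃ θ : ℝ, 0 ≤ θ ∧ θ ≤ 4 * var f y / δ ^ 2 ∧
      ent y + (1 - θ) * ent ν - Real.binEntropy θ ≤ ent (ν * y) := by
  classical
  set q : A → Prop := fun x => ‖f x - expect f y‖ < δ / 2
  set g : AddMonoidAlgebra ℝ A := .ofCoeff (y.coeff.filter q) with hg
  set b : AddMonoidAlgebra ℝ A := .ofCoeff (y.coeff.filter fun x => ¬ q x) with hb
  have hgb : g + b = y := by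
    ext x
    simp [hg, hb]
  have hgn : IsNonneg g := fun x => by
    simp only [hg, AddMonoidAlgebra.coeff_ofCoeff, Finsupp.filter_apply]
    split_ifs; exacts [hy x, le_rfl]
  have hbn : IsNonneg b := fun x => by
    simp only [hb, AddMonoidAlgebra.coeff_ofCoeff, Finsupp.filter_apply]
    split_ifs; exacts [le_rfl, hy x]
  have hm : mass g + mass b = 1 := by rw [← mass_add, hgb, hy1]
  have hgs : ∀ x ∈ g.coeff.support, q x := fun x hx => by
    simp only [hg, AddMonoidAlgebra.coeff_ofCoeff, Finsupp.support_filter, Finset.mem_filter] at hx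
    exact hx.2
  have hbs : ∀ x ∈ b.coeff.support, ¬ q x := fun x hx => by
    simp only [hb, AddMonoidAlgebra.coeff_ofCoeff, Finsupp.support_filter, Finset.mem_filter] at hx
    exact hx.2
  refine ⟨mass b, mass_nonneg hbn, ?_, ?_⟩
  · have h1 : expect (fun _ => (δ / 2) ^ 2) b ≤ expect (fun x => ‖f x - expect f y‖ ^ 2) b :=
      expect_mono hbn fun x hx =>
        pow_le_pow_left₀ (by positivity) (not_lt.1 (hbs x hx)) 2
    have h2 : (0 : ℝ) ≤ expect (fun x => ‖f x - expect f y‖ ^ 2) g :=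
      Finset.sum_nonneg fun x _ => mul_nonneg (hgn x) (by positivity)
    have h3 : var f y = expect (fun x => ‖f x - expect f y‖ ^ 2) g +
        expect (fun x => ‖f x - expect f y‖ ^ 2) b := by
      rw [← expect_add, hgb]; rfl
    rw [expect_const, smul_eq_mul] at h1
    rw [le_div_iff₀ (by positivity)]
    nlinarith
  · have := ent_mul_ge_of_unique hν hgn hbn hν1 hm ?_ ?_
    · rw [hgb] at this
      rw [← eq_sub_of_add_eq hm]
      linarith
    · exact Finset.disjoint_left.2 fun x hx hx' => hbs x hx' (hgs x hx)
    · intro x hx x' hx' z hz z' hz' h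
      by_contra hne
      have h1 := hsep x hx x' hx' hne
      have h2 : f x - f x' = (f z' - expect f y) - (f z - expect f y) := by
        have := congrArg f h
        rw [map_add, map_add] at this
        linear_combination this
      rw [h2] at h1
      have h3 := norm_sub_le (f z' - expect f y) (f z - expect f y)
      have h4 : ‖f z - expect f y‖ < δ / 2 := hgs z hz
      have h5 : ‖f z' - expect f y‖ < δ / 2 := hgs z' hz'
      linarith

end Variance

/-! ### Sums of independent copies of a finitely valued variable -/

section Law

variable {A : Type*} {m : ℕ}

/-- The weight with mass `p j` at `t j`. -/
noncomputable def law (t : Fin m → A) (p : Fin m → ℝ) : AddMonoidAlgebra ℝ A :=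
  ∑ j, AddMonoidAlgebra.single (t j) (p j)

lemma isNonneg_law (t : Fin m → A) {p : Fin m → ℝ} (hp : ∀ j, 0 ≤ p j) : IsNonneg (law t p) :=
  .sum fun j _ => .single _ (hp j)

lemma mass_law (t : Fin m → A) {p : Fin m → ℝ} (hp : ∑ j, p j = 1) : mass (law t p) = 1 := by
  simp only [law, mass_sum, mass_single, hp]

lemma exists_of_mem_support_law {t : Fin m → A} {p : Fin m → ℝ} {x : A}
    (hx : x ∈ (law t p).coeff.support) : ∃ j, t j = x := by
  classical
  rw [law, AddMonoidAlgebra.coeff_sum] at hx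
  obtain ⟨j, -, hj⟩ := Finset.mem_biUnion.1 (Finsupp.support_finsetSum hx)
  exact ⟨j, (Finset.mem_singleton.1 (Finsupp.support_single_subset hj)).symm⟩

lemma ent_law {t : Fin m → A} (ht : Function.Injective t) (p : Fin m → ℝ) :
    ent (law t p) = vectorEntropy p := by
  classical
  have hc : ∀ j, (law t p).coeff (t j) = p j := fun j => by
    simp [law, AddMonoidAlgebra.coeff_sum, Finsupp.single_apply, ht.eq_iff]
  have hs : (law t p).coeff.support ⊆ Finset.univ.image t := fun x hx => by
    obtain ⟨j, rfl⟩ := exists_of_mem_support_law hx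
    simp
  rw [ent, expect_eq_sum _ _ hs, Finset.sum_image ht.injOn, vectorEntropy]
  simp [hc, Real.negMulLog]

variable [AddCommGroup A]

lemma exists_add_of_mem_support_mul {a b : AddMonoidAlgebra ℝ A} {x : A}
    (hx : x ∈ (a * b).coeff.support) :
    ∃ y ∈ a.coeff.support, ∃ z ∈ b.coeff.support, x = y + z := by
  by_contra! h
  rw [Finsupp.mem_support_iff, coeff_mul_eq_expect] at hx
  refine hx (Finset.sum_eq_zero fun y hy => ?_)
  have : b.coeff (-y + x) = 0 := by
    by_contra h0
    exact h y hy (-y + x) (Finsupp.mem_support_iff.2 h0) (by abel)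
  simp [this]

lemma exists_of_mem_support_law_pow (t : Fin m → A) (p : Fin m → ℝ) (k : ℕ) {x : A}
    (hx : x ∈ (law t p ^ k).coeff.support) :
    ∃ n ∈ Fintype.piFinset fun _ : Fin m => Finset.range (k + 1), ∑ j, n j • t j = x := by
  classical
  induction k generalizing x with
  | zero =>
    refine ⟨fun _ => 0, by simp, ?_⟩
    rw [pow_zero, AddMonoidAlgebra.one_def] at hx
    have := Finset.mem_singleton.1 (Finsupp.support_single_subset hx)
    rw [this]; simp
  | succ k ih =>
    rw [pow_succ] at hx
    obtain ⟨y, hy, z, hz, rfl⟩ := exists_add_of_mem_support_mul hx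
    obtain ⟨n, hn, rfl⟩ := ih hy
    obtain ⟨i, rfl⟩ := exists_of_mem_support_law hz
    refine ⟨n + Pi.single i 1, ?_, ?_⟩
    · simp only [Fintype.mem_piFinset, Finset.mem_range, Pi.add_apply] at hn ⊢
      intro j
      have := hn j
      have : (Pi.single i 1 : Fin m → ℕ) j ≤ 1 := by
        rw [Pi.single_apply]; split_ifs <;> simp
      omega
    · simp [add_smul, Finset.sum_add_distrib, Pi.single_apply]

lemma ent_law_pow_le (t : Fin m → A) {p : Fin m → ℝ} (hp : ∀ j, 0 ≤ p j) (hp1 : ∑ j, p j = 1)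
    (k : ℕ) : ent (law t p ^ k) ≤ m * Real.log (k + 1) := by
  classical
  set S := (Fintype.piFinset fun _ : Fin m => Finset.range (k + 1)).image
    fun n => ∑ j, n j • t j with hS
  have hsub : (law t p ^ k).coeff.support ⊆ S := fun x hx => by
    obtain ⟨n, hn, rfl⟩ := exists_of_mem_support_law_pow t p k hx
    exact Finset.mem_image_of_mem _ hn
  have h1 := mass_pow_eq_one (mass_law t hp1) k
  refine (ent_le_log_card ((isNonneg_law t hp).pow k) h1 hsub).trans ?_
  have hne : 0 < S.card := by
    refine Finset.card_pos.2 (Finset.Nonempty.image ⟨0, by simp⟩ _)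
  rw [← Real.log_pow]
  refine Real.log_le_log (by exact_mod_cast hne) ?_
  have : S.card ≤ (k + 1) ^ m := Finset.card_image_le.trans (by simp)
  exact_mod_cast this

/-- The sum of many independent copies hides one more copy: the entropy of a `k`-fold sum grows
only logarithmically in `k`, so that some increment is small. -/
lemma exists_pow_hides (t : Fin m → A) {p : Fin m → ℝ} (hp : ∀ j, 0 ≤ p j) (hp1 : ∑ j, p j = 1)
    {ε : ℝ} (hε : 0 < ε) :
    ∃ k : ℕ, ent (law t p * law t p ^ k) - ent (law t p ^ k) ≤ ε := by
  by_contra! h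
  have hlow : ∀ k : ℕ, k * ε ≤ ent (law t p ^ k) := by
    intro k
    induction k with
    | zero => simp [ent_one]
    | succ k ih =>
      have := h k
      rw [← pow_succ'] at this
      push_cast
      linarith
  have hc : 0 < ε / (2 * (m + 1)) := by positivity
  have ho := (Real.isLittleO_log_id_atTop.bound hc)
  have ho' := (Filter.tendsto_atTop_add_const_right Filter.atTop (1 : ℝ)
    (tendsto_natCast_atTop_atTop (R := ℝ))).eventually ho
  obtain ⟨k, hk, hk2⟩ := (ho'.and (Filter.eventually_ge_atTop 2)).exists
  have hk2' : (2 : ℝ) ≤ k := by exact_mod_cast hk2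
  rw [Real.norm_eq_abs, id, Real.norm_of_nonneg (by positivity)] at hk
  have h1 := (hlow k).trans (ent_law_pow_le t hp hp1 k)
  have h2 : (m : ℝ) * Real.log (k + 1) ≤ (m + 1) * (ε / (2 * (m + 1)) * (k + 1)) :=
    mul_le_mul (by linarith) ((le_abs_self _).trans hk)
      (Real.log_nonneg (by linarith)) (by positivity)
  have h3 : ((m : ℝ) + 1) * (ε / (2 * (m + 1)) * (k + 1)) = ε / 2 * (k + 1) := by
    field_simp
  nlinarith

end Law

/-! ### Partial sums of a random power series -/

section Dilation

/-- The image of a weight on `ℂ` under multiplication by `η`. -/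
noncomputable def dil (η : ℂ) : AddMonoidAlgebra ℝ ℂ →+* AddMonoidAlgebra ℝ ℂ :=
  AddMonoidAlgebra.mapDomainRingHom ℝ (AddMonoidHom.mulLeft η)

lemma dil_single (η x : ℂ) (r : ℝ) :
    dil η (AddMonoidAlgebra.single x r) = AddMonoidAlgebra.single (η * x) r := by
  simp [dil]

lemma dil_one (a : AddMonoidAlgebra ℝ ℂ) : dil 1 a = a := by
  induction a using AddMonoidAlgebra.induction_linear with
  | zero => simp
  | add a a' h h' => rw [map_add, h, h']
  | single x r => rw [dil_single, one_mul]

lemma dil_dil (η ζ : ℂ) (a : AddMonoidAlgebra ℝ ℂ) : dil η (dil ζ a) = dil (η * ζ) a := by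
  induction a using AddMonoidAlgebra.induction_linear with
  | zero => simp
  | add a a' h h' => simp only [map_add, h, h']
  | single x r => simp only [dil_single, mul_assoc]

lemma mulLeft_injective' {η : ℂ} (hη : η ≠ 0) : Function.Injective (AddMonoidHom.mulLeft η) :=
  mul_right_injective₀ hη

lemma ent_dil {η : ℂ} (hη : η ≠ 0) (a : AddMonoidAlgebra ℝ ℂ) : ent (dil η a) = ent a :=
  ent_map (mulLeft_injective' hη) a

lemma mass_dil (η : ℂ) (a : AddMonoidAlgebra ℝ ℂ) : mass (dil η a) = mass a := mass_map _ a

lemma IsNonneg.dil (η : ℂ) {a : AddMonoidAlgebra ℝ ℂ} (ha : IsNonneg a) :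
    IsNonneg (dil η a) := ha.map _

/-- The law of `∑ j < n, ξ_j η ^ j` for independent `ξ_j` of law `ν`. -/
noncomputable def partialSum (η : ℂ) (ν : AddMonoidAlgebra ℝ ℂ) (n : ℕ) : AddMonoidAlgebra ℝ ℂ :=
  ∏ j ∈ Finset.range n, dil (η ^ j) ν

variable {η : ℂ} {ν : AddMonoidAlgebra ℝ ℂ}

lemma IsNonneg.partialSum (η : ℂ) (hν : IsNonneg ν) (n : ℕ) : IsNonneg (partialSum η ν n) :=
  .prod fun _ _ => hν.dil _

lemma mass_partialSum (η : ℂ) (hν : mass ν = 1) (n : ℕ) : mass (partialSum η ν n) = 1 :=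
  mass_prod_eq_one fun _ _ => (mass_dil _ _).trans hν

lemma partialSum_add (η : ℂ) (ν : AddMonoidAlgebra ℝ ℂ) (k n : ℕ) :
    partialSum η ν (k + n) = partialSum η ν k * dil (η ^ k) (partialSum η ν n) := by
  simp only [partialSum, Finset.prod_range_add, map_prod, dil_dil, pow_add]

lemma partialSum_succ (η : ℂ) (ν : AddMonoidAlgebra ℝ ℂ) (n : ℕ) :
    partialSum η ν (n + 1) = ν * dil η (partialSum η ν n) := by
  rw [add_comm, partialSum_add]; simp [partialSum, dil_one]

lemma subadditive_ent_partialSum (hη : η ≠ 0) (hν : IsNonneg ν) (hν1 : mass ν = 1) :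
    Subadditive fun n => ent (partialSum η ν n) := fun k n => by
  beta_reduce
  rw [partialSum_add]
  refine (ent_mul_le (hν.partialSum η k) ((hν.partialSum η n).dil _) (mass_partialSum η hν1 k)
    ((mass_dil _ _).trans (mass_partialSum η hν1 n))).trans_eq ?_
  rw [ent_dil (pow_ne_zero _ hη)]

/-- The entropy of the partial sums is at least `n * h` as soon as there is an additive functional
`Φ` on `ℂ` that sends `t_j η^(-i)` to `c_i s_j` with `c_0 = 1`, for well separated `s_j` and a
sequence `c_1, c_2, …` of small `ℓ²` norm: the noise `∑ i ≥ 1, u_i η^(-i)`, where each `u_i` is a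
sum of `k` copies of `ξ`, then hides little of `ξ`. -/
lemma exists_forall_le_ent_partialSum {m : ℕ} {t : Fin m → ℂ} {p : Fin m → ℝ}
    (ht : Function.Injective t) (hp : ∀ j, 0 ≤ p j) (hp1 : ∑ j, p j = 1) {h : ℝ}
    (hh : h < vectorEntropy p) (R : ℝ) {δ : ℝ} (hδ : 0 < δ) :
    ∃ v : ℝ, 0 < v ∧ ∀ η : ℂ, η ≠ 0 → ∀ (Φ : ℂ →+ ℂ) (s : Fin m → ℂ) (c : ℕ → ℂ),
      (∀ j, ‖s j‖ ≤ R) → (∀ i j, i ≠ j → δ ≤ ‖s i - s j‖) → (∀ j, Φ (t j) = s j) →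
      (∀ i j, Φ (η⁻¹ ^ (i + 1) * t j) = c i * s j) →
      (∀ N, ∑ i ∈ Finset.range N, ‖c i‖ ^ 2 ≤ v) →
      ∀ n : ℕ, n * h ≤ ent (partialSum η (law t p) n) := by
  set ν := law t p with hν_def
  have hν : IsNonneg ν := isNonneg_law t hp
  have hν1 : mass ν = 1 := mass_law t hp1
  have hH : ent ν = vectorEntropy p := ent_law ht p
  set ε := (vectorEntropy p - h) / 2 with hε_def
  have hε : 0 < ε := by rw [hε_def]; linarith
  obtain ⟨k, hk⟩ := exists_pow_hides t hp hp1 hε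
  obtain ⟨κ, hκ, hκle⟩ : ∃ κ > 0, ∀ θ : ℝ, 0 ≤ θ → θ ≤ κ →
      θ * vectorEntropy p + Real.binEntropy θ ≤ ε := by
    have hcont : Continuous fun θ : ℝ => θ * vectorEntropy p + Real.binEntropy θ := by fun_prop
    have := (hcont.tendsto 0).eventually_lt_const (u := ε) (by simpa using hε)
    obtain ⟨κ, hκ, hlt⟩ := Metric.eventually_nhds_iff.1 this
    refine ⟨κ / 2, by positivity, fun θ h0 h1 => (hlt ?_).le⟩
    rw [Real.dist_eq, sub_zero, abs_of_nonneg h0]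
    linarith
  refine ⟨κ * δ ^ 2 / (4 * (k * R ^ 2 + 1)), by positivity, ?_⟩
  intro η hη Φ s c hsR hsδ hΦ hΦc hc n
  set Y : ℕ → AddMonoidAlgebra ℝ ℂ := fun N =>
    ∏ i ∈ Finset.range N, dil (η⁻¹ ^ (i + 1)) (ν ^ k) with hY
  have hYp : ∀ N, IsNonneg (Y N) := fun N => .prod fun i _ => (hν.pow k).dil _
  have hk1 : mass (ν ^ k) = 1 := mass_pow_eq_one hν1 k
  have hY1 : ∀ N, mass (Y N) = 1 := fun N =>
    mass_prod_eq_one fun i _ => (mass_dil _ _).trans hk1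
  have hvar : ∀ N, 4 * var Φ (Y N) / δ ^ 2 ≤ κ := by
    intro N
    have h1 : var Φ (Y N) ≤ (k * R ^ 2) * ∑ i ∈ Finset.range N, ‖c i‖ ^ 2 := by
      rw [hY, var_prod Φ fun i _ => (mass_dil _ _).trans hk1, Finset.mul_sum]
      refine Finset.sum_le_sum fun i _ => ?_
      have : var (fun x => Φ (η⁻¹ ^ (i + 1) * x)) ν ≤ (‖c i‖ * R) ^ 2 := by
        refine var_le_sq hν hν1 fun x hx => ?_
        obtain ⟨j, rfl⟩ := exists_of_mem_support_law hx
        rw [hΦc, norm_mul]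
        exact mul_le_mul_of_nonneg_left (hsR j) (norm_nonneg _)
      rw [map_pow, var_pow Φ ((mass_dil _ _).trans hν1), dil, var_map]
      calc _ ≤ (k : ℝ) * (‖c i‖ * R) ^ 2 := mul_le_mul_of_nonneg_left this (by positivity)
        _ = _ := by ring
    have h2 : (k * R ^ 2) * ∑ i ∈ Finset.range N, ‖c i‖ ^ 2 ≤
        (k * R ^ 2 + 1) * (κ * δ ^ 2 / (4 * (k * R ^ 2 + 1))) :=
      mul_le_mul (by linarith) (hc N) (Finset.sum_nonneg fun _ _ => by positivity) (by positivity)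
    have h3 : (k * R ^ 2 + 1) * (κ * δ ^ 2 / (4 * (k * R ^ 2 + 1))) = κ * δ ^ 2 / 4 := by
      field_simp
    rw [div_le_iff₀ (by positivity)]
    linarith
  have hsee : ∀ N, ent (Y N) + (vectorEntropy p - ε) ≤ ent (ν * Y N) := by
    intro N
    obtain ⟨θ, h0, h1, h2⟩ := ent_mul_ge_of_var hν hν1 (hYp N) (hY1 N) Φ hδ (by
      intro x hx x' hx' hne
      obtain ⟨i, rfl⟩ := exists_of_mem_support_law hx
      obtain ⟨j, rfl⟩ := exists_of_mem_support_law hx'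
      rw [hΦ, hΦ]
      exact hsδ i j fun hij => hne (by rw [hij]))
    have h3 := hκle θ h0 (h1.trans (hvar N))
    rw [hH] at h2
    linarith
  have := ent_mul_noise_ge (mulLeft_injective' hη) hν hν1 (hν.pow k) hk1
    (X := partialSum η ν) (Y := Y) (by simp [partialSum]) (fun n => partialSum_succ η ν n)
    (hν.partialSum η) (mass_partialSum η hν1) (fun N => ?_) hYp hY1 hsee hk n 0
  · simp only [hY, Finset.range_zero, Finset.prod_empty, ent_one, mul_one, add_zero] at this
    refine le_trans (le_of_eq ?_) this
    rw [hε_def]; ring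
  · change dil η (Y (N + 1)) = _
    simp only [hY, map_prod, dil_dil]
    rw [Finset.prod_range_succ', mul_comm]
    congr 1
    · rw [zero_add, pow_one, mul_inv_cancel₀ hη, dil_one]
    · refine Finset.prod_congr rfl fun i _ => ?_
      rw [pow_succ' _ (i + 1), mul_inv_cancel_left₀ hη]

lemma exists_of_mem_support_partialSum {m : ℕ} [NeZero m] {t : Fin m → ℂ} {p : Fin m → ℝ} (η : ℂ)
    (n : ℕ) {x : ℂ} (hx : x ∈ (partialSum η (law t p) n).coeff.support) :
    ∃ i : ℕ → Fin m, x = ∑ l ∈ Finset.range n, t (i l) * η ^ l := by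
  induction n generalizing x with
  | zero =>
    refine ⟨fun _ => 0, ?_⟩
    rw [partialSum, Finset.prod_range_zero, AddMonoidAlgebra.one_def] at hx
    simpa using Finset.mem_singleton.1 (Finsupp.support_single_subset hx)
  | succ n ih =>
    rw [partialSum, Finset.prod_range_succ] at hx
    obtain ⟨y, hy, z, hz, rfl⟩ := exists_add_of_mem_support_mul hx
    obtain ⟨i, rfl⟩ := ih hy
    have hz' : z ∈ (law (fun j => η ^ n * t j) p).coeff.support := by
      simpa [law, dil_single] using hz
    obtain ⟨j, rfl⟩ := exists_of_mem_support_law hz'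
    refine ⟨Function.update i n j, ?_⟩
    rw [Finset.sum_range_succ, Function.update_self, mul_comm (η ^ n)]
    congr 1
    refine Finset.sum_congr rfl fun l hl => ?_
    rw [Function.update_of_ne (Finset.mem_range.1 hl).ne]

/-- Without exact overlaps, that is, if `η` is a root of no nonzero polynomial with coefficients in
the difference set of `t`, the entropy of the partial sums is the largest possible. -/
lemma ent_partialSum_of_no_overlap {m : ℕ} {t : Fin m → ℂ} {p : Fin m → ℝ}
    (ht : Function.Injective t) (hp1 : ∑ j, p j = 1)
    (hη : η ≠ 0) (hno : ∀ P : Polynomial ℂ, (∀ l, ∃ a b, P.coeff l = t a - t b) →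
      P.eval η = 0 → P = 0) (n : ℕ) :
    ent (partialSum η (law t p) n) = n * vectorEntropy p := by
  have : NeZero m := ⟨by rintro rfl; simp at hp1⟩
  have hν1 : mass (law t p) = 1 := mass_law t hp1
  induction n with
  | zero => simp [partialSum, ent_one]
  | succ n ih =>
    rw [partialSum_add, mul_comm, ent_mul_of_unique, mass_partialSum η hν1, mass_dil,
      mass_partialSum η hν1, ih, ent_dil (pow_ne_zero _ hη)]
    · simp [partialSum, dil_one, ent_law ht]; ring
    · intro x hx x' hx' y hy y' hy' h
      have hlaw : dil (η ^ n) (partialSum η (law t p) 1) = law (fun j => η ^ n * t j) p := by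
        simp [partialSum, law, dil_single]
      rw [hlaw] at hx hx'
      obtain ⟨a, rfl⟩ := exists_of_mem_support_law hx
      obtain ⟨b, rfl⟩ := exists_of_mem_support_law hx'
      obtain ⟨i, rfl⟩ := exists_of_mem_support_partialSum η n hy
      obtain ⟨i', rfl⟩ := exists_of_mem_support_partialSum η n hy'
      set P : Polynomial ℂ := ∑ l ∈ Finset.range n, Polynomial.C (t (i l) - t (i' l)) * .X ^ l +
        Polynomial.C (t a - t b) * .X ^ n with hP
      have hcoeff : ∀ l, P.coeff l =
          (if l < n then t (i l) - t (i' l) else 0) + if l = n then t a - t b else 0 := by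
        intro l
        simp only [hP, Polynomial.coeff_add, Polynomial.finsetSum_coeff, Polynomial.coeff_C_mul,
          Polynomial.coeff_X_pow, mul_ite, mul_one, mul_zero, Finset.sum_ite_eq, Finset.mem_range]
      have hP0 : P = 0 := by
        refine hno P (fun l => ?_) ?_
        · rw [hcoeff]
          rcases lt_trichotomy l n with hl | rfl | hl
          · exact ⟨i l, i' l, by simp [hl, hl.ne]⟩
          · exact ⟨a, b, by simp⟩
          · exact ⟨a, a, by simp [hl.ne', hl.not_gt]⟩
        · simp only [hP, Polynomial.eval_add, Polynomial.eval_finsetSum, Polynomial.eval_mul,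
            Polynomial.eval_C, Polynomial.eval_pow, Polynomial.eval_X, sub_mul,
            Finset.sum_sub_distrib]
          linear_combination h
      have := hcoeff n
      rw [hP0] at this
      simp only [Polynomial.coeff_zero, lt_irrefl, if_false, if_true, zero_add] at this
      rw [sub_eq_zero.1 this.symm]

end Dilation

/-! ### The integral minimal polynomial and exact overlaps -/

section IntMinpoly

open Polynomial

lemma isPrimitive_intMinpoly (η : ℂ) : (intMinpoly η).IsPrimitive := isPrimitive_primPart _

lemma exists_intMinpoly_map {η : ℂ} (hη : IsAlgebraic ℚ η) :
    ∃ u : ℚ, u ≠ 0 ∧ (intMinpoly η).map (Int.castRingHom ℚ) = C u * minpoly ℚ η := by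
  set N := IsLocalization.integerNormalization (nonZeroDivisors ℤ) (minpoly ℚ η) with hN
  have hm : minpoly ℚ η ≠ 0 := minpoly.ne_zero hη.isIntegral
  have hN0 : N ≠ 0 := by
    rw [hN, Ne, IsLocalization.integerNormalization_eq_zero_iff le_rfl]; exact hm
  obtain ⟨b, hbmem, hb⟩ : ∃ b ∈ nonZeroDivisors ℤ, N.map (algebraMap ℤ ℚ) = b • minpoly ℚ η :=
    IsLocalization.integerNormalization_spec _ _
  have hb0 : (b : ℚ) ≠ 0 := by exact_mod_cast nonZeroDivisors.ne_zero hbmem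
  have hc0 : ((N.content : ℤ) : ℚ) ≠ 0 := by
    exact_mod_cast fun h => hN0 (content_eq_zero_iff.1 h)
  refine ⟨(b : ℚ) / (N.content : ℤ), div_ne_zero hb0 hc0, ?_⟩
  have h1 : N.map (Int.castRingHom ℚ) =
      C ((N.content : ℤ) : ℚ) * (intMinpoly η).map (Int.castRingHom ℚ) := by
    conv_lhs => rw [N.eq_C_content_mul_primPart]
    simp [intMinpoly, hN]
  have h2 : C ((N.content : ℤ) : ℚ) * (intMinpoly η).map (Int.castRingHom ℚ) =
      C (b : ℚ) * minpoly ℚ η := by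
    rw [← h1]
    change N.map (algebraMap ℤ ℚ) = _
    rw [hb, zsmul_eq_mul]; simp
  have hC : (C ((N.content : ℤ) : ℚ) : ℚ[X]) ≠ 0 := C_ne_zero.2 hc0
  apply mul_left_cancel₀ hC
  rw [h2, ← mul_assoc, ← C_mul, mul_div_cancel₀ _ hc0]

lemma roots_map_intMinpoly {η : ℂ} (hη : IsAlgebraic ℚ η) :
    ((intMinpoly η).map (Int.castRingHom ℂ)).roots = (minpoly ℚ η).aroots ℂ := by
  obtain ⟨u, hu, h⟩ := exists_intMinpoly_map hη
  have : (intMinpoly η).map (Int.castRingHom ℂ) =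
      ((intMinpoly η).map (Int.castRingHom ℚ)).map (algebraMap ℚ ℂ) := by
    rw [map_map]; congr 1
  rw [this, h, Polynomial.map_mul, map_C, roots_C_mul]
  simpa using hu

/-- The Mahler measure with the product taken over the set of conjugates, which are simple roots. -/
lemma algMahlerMeasure_eq {η : ℂ} (hη : IsAlgebraic ℚ η) :
    algMahlerMeasure η = ‖((intMinpoly η).leadingCoeff : ℂ)‖ *
      ∏ x ∈ ((minpoly ℚ η).aroots ℂ).toFinset, max 1 ‖x‖ := by
  have hsep : (minpoly ℚ η).Separable := (minpoly.irreducible hη.isIntegral).separable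
  have hnodup : ((minpoly ℚ η).aroots ℂ).Nodup := nodup_roots (hsep.map)
  rw [algMahlerMeasure, roots_map_intMinpoly hη, Finset.prod_eq_multiset_prod,
    Multiset.toFinset_val, hnodup.dedup]

/-- If `η` is a root of a nonzero polynomial over a Galois number field whose coefficients become
integral after multiplication by `c`, then the leading coefficient of the integral minimal
polynomial of `η` is at most the norm of `c` times the leading coefficient: the product of the
Galois conjugates of the polynomial is an integral polynomial that vanishes at `η`. -/
lemma norm_leadingCoeff_intMinpoly_le {L : IntermediateField ℚ ℂ} [FiniteDimensional ℚ L]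
    [IsGalois ℚ L] {η : ℂ} (hη : IsAlgebraic ℚ η) {P : L[X]} {c : ℤ} (hc : c ≠ 0)
    (hint : ∀ l, IsIntegral ℤ (c • P.coeff l)) (hP : P ≠ 0)
    (hroot : (P.map (algebraMap L ℂ)).eval η = 0) :
    ‖((intMinpoly η).leadingCoeff : ℂ)‖ ≤
      ‖algebraMap L ℂ (∏ g : L ≃ₐ[ℚ] L, g (c • P.leadingCoeff))‖ := by
  set Q : L[X] := c • P with hQ
  set G : L[X] := ∏ g : L ≃ₐ[ℚ] L, Q.map (g : L →+* L) with hG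
  have hQ0 : Q ≠ 0 := smul_ne_zero hc hP
  have hlcQ : Q.leadingCoeff = c • P.leadingCoeff := by
    rw [hQ, leadingCoeff, natDegree_smul _ hc, coeff_smul, leadingCoeff]
  have hmem : G ∈ lifts (algebraMap (integralClosure ℤ L) L) := by
    refine prod_mem fun g _ => ?_
    rw [lifts_iff_coeff_lifts]
    intro n
    rw [coeff_map]
    have : IsIntegral ℤ (g (Q.coeff n)) := by
      have := (hint n).map (g.restrictScalars ℤ : L →ₐ[ℤ] L)
      simpa [hQ] using this
    exact ⟨⟨_, this⟩, rfl⟩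
  have hfix : ∀ h : L ≃ₐ[ℚ] L, G.map (h : L →+* L) = G := by
    intro h
    rw [hG, Polynomial.map_prod]
    simp only [map_map]
    exact Fintype.prod_equiv (Equiv.mulLeft h) _ _ fun g => rfl
  have hZ : G ∈ lifts (algebraMap ℤ L) := by
    rw [lifts_iff_coeff_lifts]
    intro n
    have hbot : G.coeff n ∈ (⊥ : IntermediateField ℚ L) := by
      rw [IsGalois.mem_bot_iff_fixed]
      intro h
      conv_rhs => rw [← hfix h]
      rw [coeff_map]; rfl
    obtain ⟨q, hq⟩ := IntermediateField.mem_bot.1 hbot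
    have hqi : IsIntegral ℤ q := by
      rw [← isIntegral_algebraMap_iff (B := L) (algebraMap ℚ L).injective, hq]
      obtain ⟨x, hx⟩ := (lifts_iff_coeff_lifts _).1 hmem n
      rw [← hx]; exact x.2
    obtain ⟨z, rfl⟩ := IsIntegrallyClosed.isIntegral_iff.1 hqi
    exact ⟨z, by rw [← hq]; simp⟩
  obtain ⟨G₁, hG₁⟩ := (mem_lifts _).1 hZ
  have hG0 : G ≠ 0 := Finset.prod_ne_zero_iff.2 fun g _ =>
    (Polynomial.map_ne_zero_iff (g : L →+* L).injective).2 hQ0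
  have hG₁0 : G₁ ≠ 0 := by rintro rfl; exact hG0 (by rw [← hG₁, Polynomial.map_zero])
  have hroot₁ : aeval η (G₁.map (Int.castRingHom ℚ)) = 0 := by
    have h1 : (G₁.map (Int.castRingHom ℚ)).map (algebraMap ℚ ℂ) = G.map (algebraMap L ℂ) := by
      rw [← hG₁, map_map, map_map]; congr 1
    rw [aeval_def, eval₂_eq_eval_map, h1, hG, Polynomial.map_prod, eval_prod]
    refine Finset.prod_eq_zero (Finset.mem_univ (1 : L ≃ₐ[ℚ] L)) ?_
    have : Q.map ((1 : L ≃ₐ[ℚ] L) : L →+* L) = Q := by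
      ext n; rw [coeff_map]; rfl
    rw [this, hQ, zsmul_eq_mul, Polynomial.map_mul, eval_mul, hroot, mul_zero]
  have hdvd : intMinpoly η ∣ G₁ := by
    rw [IsPrimitive.Int.dvd_iff_map_cast_dvd_map_cast _ _ (isPrimitive_intMinpoly η)]
    obtain ⟨u, hu, h⟩ := exists_intMinpoly_map hη
    rw [h]
    exact (C_mul_dvd hu).2 (minpoly.dvd ℚ η hroot₁)
  have hle := Int.le_of_dvd (abs_pos.2 (leadingCoeff_ne_zero.2 hG₁0))
    ((abs_dvd_abs _ _).2 (leadingCoeff_dvd_leadingCoeff hdvd))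
  have hlc : algebraMap ℤ L G₁.leadingCoeff = ∏ g : L ≃ₐ[ℚ] L, g (c • P.leadingCoeff) := by
    rw [← leadingCoeff_map_of_injective (algebraMap ℤ L).injective_int, hG₁, hG, leadingCoeff_prod]
    refine Finset.prod_congr rfl fun g _ => ?_
    rw [leadingCoeff_map, hlcQ]; rfl
  rw [← hlc, eq_intCast, map_intCast, Complex.norm_intCast, Complex.norm_intCast]
  exact_mod_cast hle

/-- The leading coefficients of the integral minimal polynomials of those `η` that are roots of
polynomials with coefficients in the difference set of `t` are bounded. -/
lemma exists_leadingCoeff_bound {m : ℕ} {t : Fin m → ℂ} (ht : ∀ j, IsAlgebraic ℚ (t j)) :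
    ∃ B : ℝ, 0 < B ∧ ∀ η : ℂ, IsAlgebraic ℚ η → ∀ P : ℂ[X],
      (∀ l, ∃ a b, P.coeff l = t a - t b) → P.eval η = 0 → P ≠ 0 →
      ‖((intMinpoly η).leadingCoeff : ℂ)‖ ≤ B := by
  classical
  set q : ℚ[X] := ∏ j, minpoly ℚ (t j) with hq
  have hq0 : q ≠ 0 := Finset.prod_ne_zero_iff.2 fun j _ => minpoly.ne_zero (ht j).isIntegral
  set L : IntermediateField ℚ ℂ := IntermediateField.adjoin ℚ (q.rootSet ℂ) with hL
  have : q.IsSplittingField ℚ L :=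
    IntermediateField.adjoin_rootSet_isSplittingField (IsAlgClosed.splits _)
  have : FiniteDimensional ℚ L := IsSplittingField.finiteDimensional L q
  have : Normal ℚ L := Normal.of_isSplittingField q
  have : IsGalois ℚ L := ⟨⟩
  have htL : ∀ j, t j ∈ L := fun j => by
    refine IntermediateField.subset_adjoin ℚ _ ((mem_rootSet_of_ne hq0).2 ?_)
    rw [hq, map_prod]
    exact Finset.prod_eq_zero (Finset.mem_univ j) (minpoly.aeval ℚ (t j))
  set t' : Fin m → L := fun j => ⟨t j, htL j⟩ with ht'
  obtain ⟨c, hc, hint⟩ := exists_integral_multiples ℤ ℚ (Finset.univ.image t')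
  set F : Fin m × Fin m → ℝ := fun ab =>
    ‖algebraMap L ℂ (∏ g : L ≃ₐ[ℚ] L, g (c • (t' ab.1 - t' ab.2)))‖ with hF
  refine ⟨1 + ∑ ab, F ab, by positivity, fun η hη P hcoeff hroot hP => ?_⟩
  obtain ⟨P', rfl⟩ := (mem_lifts P).1 ((lifts_iff_coeff_lifts (f := algebraMap L ℂ) P).2 fun l => by
    obtain ⟨a, b, h⟩ := hcoeff l
    exact ⟨t' a - t' b, by rw [h]; rfl⟩)
  have hcoeff' : ∀ l, ∃ a b, P'.coeff l = t' a - t' b := fun l => by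
    obtain ⟨a, b, h⟩ := hcoeff l
    refine ⟨a, b, (algebraMap L ℂ).injective ?_⟩
    rw [← coeff_map, h]; rfl
  have hP' : P' ≠ 0 := by rintro rfl; simp at hP
  have h1 := norm_leadingCoeff_intMinpoly_le hη hc (fun l => ?_) hP' hroot
  · obtain ⟨a, b, h⟩ := hcoeff' P'.natDegree
    rw [show P'.leadingCoeff = t' a - t' b from h] at h1
    have h2 : F (a, b) ≤ ∑ ab, F ab :=
      Finset.single_le_sum (f := F) (fun _ _ => norm_nonneg _) (Finset.mem_univ (a, b))
    linarith
  · obtain ⟨a, b, h⟩ := hcoeff' l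
    rw [h, smul_sub]
    exact (hint _ (by simp)).sub (hint _ (by simp))

end IntMinpoly

/-! ### Conjugates, and the lower bound for the entropy -/

section Conjugates

open Polynomial

/-- The field of algebraic numbers in `ℂ`. -/
local notation "ℚbar" => algebraicClosure ℚ ℂ

lemma exists_algHom_apply_eq (η : ℚbar) {x : ℂ} (hx : x ∈ (minpoly ℚ (η : ℂ)).aroots ℂ) :
    ∃ τ : ℚbar →ₐ[ℚ] ℂ, τ η = x := by
  have hx' : x ∈ (minpoly ℚ η).rootSet ℂ := by
    rw [← minpoly.algebraMap_eq (algebraMap ℚbar ℂ).injective η]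
    exact Multiset.mem_toFinset.2 hx
  have : Algebra.IsAlgebraic ℚ ℚbar := algebraicClosure.isAlgebraic ℚ ℂ
  exact (Algebra.IsAlgebraic.range_eval_eq_rootSet_minpoly ℂ η).symm.subset hx'

/-- The finite set of tuples of conjugates of the entries of `t`. -/
noncomputable def conjTuples {m : ℕ} (t : Fin m → ℂ) : Finset (Fin m → ℂ) :=
  Fintype.piFinset fun j => ((minpoly ℚ (t j)).aroots ℂ).toFinset

lemma comp_mem_conjTuples {m : ℕ} (t : Fin m → ℚbar) (τ : ℚbar →ₐ[ℚ] ℂ) :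
    (fun j => τ (t j)) ∈ conjTuples fun j => (t j : ℂ) := by
  refine Fintype.mem_piFinset.2 fun j => Multiset.mem_toFinset.2 ?_
  have hint : IsIntegral ℚ (t j : ℂ) := (mem_algebraicClosure_iff.1 (t j).2).isIntegral
  rw [mem_aroots]
  refine ⟨minpoly.ne_zero hint, ?_⟩
  change aeval _ (minpoly ℚ (algebraMap ℚbar ℂ (t j))) = 0
  rw [minpoly.algebraMap_eq (algebraMap ℚbar ℂ).injective, aeval_algHom_apply, minpoly.aeval,
    map_zero]

/-- Sort the conjugates of `η` according to the effect on `t` of an embedding that produces them.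
One of the finitely many classes carries a large part of the Mahler measure. -/
lemma exists_embeddings {m : ℕ} (t : Fin m → ℚbar) (η : ℚbar) {W : ℝ}
    (h : W ^ (conjTuples fun j => (t j : ℂ)).card <
      ∏ x ∈ ((minpoly ℚ (η : ℂ)).aroots ℂ).toFinset, max 1 ‖x‖) :
    ∃ s ∈ conjTuples fun j => (t j : ℂ), ∃ (T : Finset ℂ) (τ : ℂ → ℚbar →ₐ[ℚ] ℂ),
      (∀ x ∈ T, 1 < ‖x‖ ∧ τ x η = x ∧ ∀ j, τ x (t j) = s j) ∧ W < ∏ x ∈ T, ‖x‖ := by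
  classical
  set Z := ((minpoly ℚ (η : ℂ)).aroots ℂ).toFinset with hZ
  have hτ : ∀ x : ℂ, ∃ τ : ℚbar →ₐ[ℚ] ℂ, x ∈ Z → τ η = x := fun x => by
    by_cases hx : x ∈ Z
    · obtain ⟨τ, h⟩ := exists_algHom_apply_eq η (Multiset.mem_toFinset.1 hx)
      exact ⟨τ, fun _ => h⟩
    · exact ⟨(ℚbar).val, fun h => absurd h hx⟩
  choose τ hτ using hτ
  set σ : ℂ → Fin m → ℂ := fun x j => τ x (t j) with hσ
  rw [← Finset.prod_fiberwise_of_maps_to (g := σ) (t := conjTuples fun j => (t j : ℂ))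
    (fun x _ => comp_mem_conjTuples t (τ x))] at h
  obtain ⟨s, hs, hlt⟩ : ∃ s ∈ conjTuples fun j => (t j : ℂ),
      W < ∏ x ∈ Z with σ x = s, max 1 ‖x‖ := by
    by_contra! hle
    refine h.not_ge ?_
    rw [← Finset.prod_const]
    exact Finset.prod_le_prod (fun _ _ => Finset.prod_nonneg fun _ _ => by positivity) hle
  refine ⟨s, hs, (Z.filter fun x => σ x = s).filter fun x => 1 < ‖x‖, τ, fun x hx => ?_, ?_⟩
  · simp only [Finset.mem_filter] at hx
    exact ⟨hx.2, hτ x hx.1.1, fun j => congrFun hx.1.2 j⟩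
  · rw [Finset.prod_filter]
    refine hlt.trans_eq (Finset.prod_congr rfl fun x _ => ?_)
    split_ifs with h1
    · exact max_eq_right h1.le
    · exact max_eq_left (not_lt.1 h1)

/-- A finite family of embeddings that agree on `t` and send `η` to distinct numbers of large
product has a linear combination under which the sequence `η^(-i) t_j` becomes `c_i s_j`, where
`c_0 = 1` and the remaining `c_i` are small in `ℓ²`. -/
lemma exists_functional {m : ℕ} (t : Fin m → ℚbar) {η : ℚbar} {s : Fin m → ℂ}
    {T : Finset ℂ} {τ : ℂ → ℚbar →ₐ[ℚ] ℂ}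
    (hτ : ∀ x ∈ T, 1 < ‖x‖ ∧ τ x η = x ∧ ∀ j, τ x (t j) = s j) {v : ℝ} (hv : 0 < v)
    (hT : 1 + v⁻¹ ≤ ∏ x ∈ T, ‖x‖) :
    ∃ (Φ : ℂ →+ ℂ) (c : ℕ → ℂ), (∀ j, Φ (t j) = s j) ∧
      (∀ i j, Φ ((η : ℂ)⁻¹ ^ (i + 1) * t j) = c i * s j) ∧
      ∀ N, ∑ i ∈ Finset.range N, ‖c i‖ ^ 2 ≤ v := by
  classical
  set D := ∏ x ∈ T, ‖x‖ with hD
  have hD1 : 1 < D := lt_of_lt_of_le (by have := inv_pos.2 hv; linarith) hT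
  have hprod : ∏ b ∈ T.image (·⁻¹), ‖b‖ = D⁻¹ := by
    rw [Finset.prod_image inv_injective.injOn, hD, ← Finset.prod_inv_distrib]
    simp
  obtain ⟨a, ha1, ha⟩ := exists_powerSum_small (T.image (·⁻¹)) (fun b hb => by
      obtain ⟨x, hx, rfl⟩ := Finset.mem_image.1 hb
      have := (hτ x hx).1
      exact ⟨inv_ne_zero (norm_pos_iff.1 (by linarith)), by
        rw [norm_inv]; exact inv_lt_one_of_one_lt₀ this⟩)
    (by rw [hprod]; exact inv_lt_one_of_one_lt₀ hD1)
  have hsum : ∀ F : ℂ → ℂ, ∑ b ∈ T.image (·⁻¹), F b = ∑ x ∈ T, F x⁻¹ := fun F =>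
    Finset.sum_image inv_injective.injOn
  set Φ₀ : ℚbar →ₗ[ℚ] ℂ := ∑ x ∈ T, a x⁻¹ • (τ x).toLinearMap with hΦ₀
  have hΦ₀_apply : ∀ z, Φ₀ z = ∑ x ∈ T, a x⁻¹ * τ x z := fun z => by
    simp [hΦ₀, LinearMap.sum_apply]
  -- any `ℚ`-linear extension to `ℂ` will do, as only algebraic numbers matter
  obtain ⟨Φ, hΦ⟩ := LinearMap.exists_extend (p := (ℚbar).toSubalgebra.toSubmodule) Φ₀
  have hΦ' : ∀ z : ℚbar, Φ (z : ℂ) = Φ₀ z := fun z => LinearMap.congr_fun hΦ z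
  refine ⟨Φ.toAddMonoidHom, fun i => ∑ b ∈ T.image (·⁻¹), a b * b ^ (i + 1), fun j => ?_,
    fun i j => ?_, fun N => ?_⟩
  · change Φ (t j) = s j
    rw [hΦ', hΦ₀_apply, Finset.sum_congr rfl fun x hx => by rw [(hτ x hx).2.2 j],
      ← Finset.sum_mul, ← hsum, ha1, one_mul]
  · change Φ _ = _
    have : ((η : ℂ)⁻¹ ^ (i + 1) * t j) = ((η⁻¹ ^ (i + 1) * t j : ℚbar) : ℂ) := by push_cast; rfl
    beta_reduce
    rw [this, hΦ', hΦ₀_apply, hsum, Finset.sum_mul]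
    refine Finset.sum_congr rfl fun x hx => ?_
    rw [map_mul, map_pow, map_inv₀, (hτ x hx).2.2 j, (hτ x hx).2.1, mul_assoc]
  · refine (ha N).trans ?_
    rw [hprod, div_le_iff₀ (by
      have : D⁻¹ < 1 := inv_lt_one_of_one_lt₀ hD1
      have : 0 < D⁻¹ := by positivity
      nlinarith)]
    have h2 : 1 + v⁻¹ ≤ D ^ 2 := hT.trans (by nlinarith)
    have h3 : v + 1 ≤ v * D ^ 2 := by
      have := mul_le_mul_of_nonneg_left h2 hv.le
      rwa [mul_add, mul_one, mul_inv_cancel₀ hv.ne'] at this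
    have h4 : (0 : ℝ) < D ^ 2 := by positivity
    rw [inv_pow, ← mul_le_mul_iff_left₀ h4]
    have : (D ^ 2)⁻¹ * D ^ 2 = 1 := inv_mul_cancel₀ h4.ne'
    nlinarith

lemma exists_pos_forall_le (F : Finset ℝ) (hF : ∀ x ∈ F, 0 < x) : ∃ δ > 0, ∀ x ∈ F, δ ≤ x := by
  rcases F.eq_empty_or_nonempty with rfl | hne
  · exact ⟨1, one_pos, by simp⟩
  · exact ⟨F.min' hne, hF _ (F.min'_mem hne), fun x hx => F.min'_le x hx⟩

/-- The uniform lower bound in terms of the Mahler measure, which is large either because of the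
conjugates of `η` outside the unit disc or because of the leading coefficient. -/
lemma exists_mahler_forall_le_ent_partialSum {m : ℕ} {t : Fin m → ℂ} {p : Fin m → ℝ}
    (ht_alg : ∀ j, IsAlgebraic ℚ (t j)) (ht : Function.Injective t) (hp : ∀ j, 0 ≤ p j)
    (hp1 : ∑ j, p j = 1) {h : ℝ} (hh : h < vectorEntropy p) :
    ∃ M : ℝ, 0 < M ∧ ∀ η : ℂ, IsAlgebraic ℚ η → η ≠ 0 → M ≤ algMahlerMeasure η →
      ∀ n : ℕ, n * h ≤ ent (partialSum η (law t p) n) := by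
  classical
  obtain ⟨B, hB, hlc⟩ := exists_leadingCoeff_bound ht_alg
  set S := conjTuples t with hS
  set R : ℝ := ∑ s ∈ S, ∑ j, ‖s j‖ with hR
  have hsR : ∀ s ∈ S, ∀ j, ‖s j‖ ≤ R := fun s hs j =>
    (Finset.single_le_sum (f := fun j => ‖s j‖) (fun _ _ => norm_nonneg _)
      (Finset.mem_univ j)).trans
    (Finset.single_le_sum (f := fun s : Fin m → ℂ => ∑ j, ‖s j‖)
      (fun _ _ => Finset.sum_nonneg fun _ _ => norm_nonneg _) hs)
  -- `δ` is the least distance between distinct entries of a tuple of conjugates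
  obtain ⟨δ, hδ, hδle⟩ := exists_pos_forall_le
    (((S ×ˢ (Finset.univ : Finset (Fin m × Fin m))).image
      fun x => ‖x.1 x.2.1 - x.1 x.2.2‖).filter (0 < ·)) (by simp)
  obtain ⟨v, hv, hmain⟩ := exists_forall_le_ent_partialSum ht hp hp1 hh R hδ
  set W : ℝ := 1 + v⁻¹ with hW
  refine ⟨B * W ^ S.card + 1, by positivity, fun η hη hη0 hM n => ?_⟩
  by_cases hB' : ‖((intMinpoly η).leadingCoeff : ℂ)‖ ≤ B
  · set t' : Fin m → ℚbar := fun j => ⟨t j, mem_algebraicClosure_iff.2 (ht_alg j)⟩ with ht'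
    set η' : ℚbar := ⟨η, mem_algebraicClosure_iff.2 hη⟩ with hη'
    have hbig : W ^ S.card < ∏ x ∈ ((minpoly ℚ η).aroots ℂ).toFinset, max 1 ‖x‖ := by
      rw [algMahlerMeasure_eq hη] at hM
      refine lt_of_mul_lt_mul_left ((lt_add_one _).trans_le (hM.trans ?_)) hB.le
      exact mul_le_mul_of_nonneg_right hB' (Finset.prod_nonneg fun _ _ => by positivity)
    obtain ⟨s, hs, T, τ, hτ, hT⟩ := exists_embeddings t' η' hbig
    obtain ⟨Φ, c, h1, h2, h3⟩ := exists_functional t' hτ hv hT.le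
    obtain ⟨x, hx⟩ : T.Nonempty := by
      rw [Finset.nonempty_iff_ne_empty]
      rintro rfl
      have := inv_pos.2 hv
      rw [Finset.prod_empty] at hT
      linarith
    have hsinj : ∀ i j, i ≠ j → s i ≠ s j := by
      intro i j hij h
      rw [← (hτ x hx).2.2 i, ← (hτ x hx).2.2 j] at h
      exact hij (ht (congrArg Subtype.val ((τ x).injective h)))
    refine hmain η hη0 Φ s c (hsR s hs) (fun i j hij => hδle _ ?_) h1 h2 h3 n
    rw [Finset.mem_filter, Finset.mem_image]
    exact ⟨⟨(s, (i, j)), Finset.mem_product.2 ⟨hs, Finset.mem_univ _⟩, rfl⟩,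
      norm_pos_iff.2 (sub_ne_zero.2 (hsinj i j hij))⟩
  · rw [ent_partialSum_of_no_overlap ht hp1 hη0 fun P hP hroot => by
      by_contra hP0
      exact hB' (hlc η hη P hP hroot hP0)]
    exact mul_le_mul_of_nonneg_left hh.le (Nat.cast_nonneg n)

end Conjugates

/-! ### Passage from the product measure to the convolution algebra -/

section Measure

variable {m : ℕ} {t : Fin m → ℂ} {p : Fin m → ℝ}

lemma pi_atomicMeasure (hp : ∀ j, 0 ≤ p j) (n : ℕ) :
    (Measure.pi fun _ : Fin n => atomicMeasure t p) =
      ∑ f : Fin n → Fin m, ENNReal.ofReal (∏ j, p (f j)) • Measure.dirac fun j => t (f j) := by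
  have : IsFiniteMeasure (atomicMeasure t p) := ⟨by
    simp only [atomicMeasure, Measure.coe_finsetSum, Finset.sum_apply, Measure.smul_apply,
      Measure.dirac_apply_of_mem (Set.mem_univ _), smul_eq_mul, mul_one]
    exact ENNReal.sum_lt_top.2 fun _ _ => ENNReal.ofReal_lt_top⟩
  refine Measure.pi_eq fun s hs => ?_
  simp only [atomicMeasure, Measure.coe_finsetSum, Finset.sum_apply, Measure.smul_apply,
    smul_eq_mul]
  rw [Finset.prod_univ_sum, Fintype.piFinset_univ]
  refine Finset.sum_congr rfl fun f _ => ?_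
  rw [Finset.prod_mul_distrib, ENNReal.ofReal_prod_of_nonneg fun j _ => hp _,
    Measure.dirac_apply' _ (MeasurableSet.univ_pi hs)]
  congr 1
  simp only [Measure.dirac_apply' _ (hs _)]
  by_cases h : ∀ j, t (f j) ∈ s j
  · rw [Set.indicator_of_mem (by simpa using h)]
    simp [h]
  · rw [Set.indicator_of_notMem (by simpa using h)]
    push Not at h
    obtain ⟨j, hj⟩ := h
    exact (Finset.prod_eq_zero (Finset.mem_univ j) (Set.indicator_of_notMem hj _)).symm

lemma partialSum_law_eq (η : ℂ) (n : ℕ) :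
    partialSum η (law t p) n = ∑ f : Fin n → Fin m,
      AddMonoidAlgebra.single (∑ j, t (f j) * η ^ (j : ℕ)) (∏ j, p (f j)) := by
  rw [partialSum, ← Fin.prod_univ_eq_prod_range (fun j => dil (η ^ j) (law t p))]
  simp only [law, map_sum, dil_single]
  rw [Finset.prod_univ_sum, Fintype.piFinset_univ]
  refine Finset.sum_congr rfl fun f _ => ?_
  rw [AddMonoidAlgebra.prod_single]
  simp only [mul_comm]

lemma partialSumEntropy_eq_ent (hp : ∀ j, 0 ≤ p j) (η : ℂ) (n : ℕ) :
    partialSumEntropy η (atomicMeasure t p) n = ent (partialSum η (law t p) n) := by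
  classical
  set X : (Fin n → ℂ) → ℂ := fun ξ => ∑ j, ξ j * η ^ (j : ℕ) with hX
  have hXm : Measurable X := by fun_prop
  have key : ∀ x, (Measure.pi fun _ : Fin n => atomicMeasure t p).real (X ⁻¹' {x}) =
      (partialSum η (law t p) n).coeff x := by
    intro x
    rw [pi_atomicMeasure hp, partialSum_law_eq, AddMonoidAlgebra.coeff_sum, Finsupp.finsetSum_apply,
      measureReal_def, Measure.coe_finsetSum, Finset.sum_apply, ENNReal.toReal_sum fun f _ => ?_]
    · refine Finset.sum_congr rfl fun f _ => ?_
      rw [Measure.smul_apply, Measure.dirac_apply' _ (hXm (measurableSet_singleton x)),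
        AddMonoidAlgebra.coeff_single, Finsupp.single_apply, Set.indicator_apply, smul_eq_mul,
        ENNReal.toReal_mul, ENNReal.toReal_ofReal (Finset.prod_nonneg fun _ _ => hp _)]
      simp only [Set.mem_preimage, Set.mem_singleton_iff, hX]
      split_ifs <;> simp
    · rw [Measure.smul_apply, smul_eq_mul]
      exact ENNReal.mul_ne_top ENNReal.ofReal_ne_top (measure_ne_top _ _)
  change ∑' x : ℂ, Real.negMulLog ((Measure.pi fun _ : Fin n => atomicMeasure t p).real
    (X ⁻¹' {x})) = _
  simp only [key]
  rw [tsum_eq_sum (s := (partialSum η (law t p) n).coeff.support) fun x hx => by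
    rw [Finsupp.notMem_support_iff.1 hx, Real.negMulLog_zero]]
  refine Finset.sum_congr rfl fun x _ => ?_
  simp [Real.negMulLog]

end Measure

end Garsia

theorem theorem1p4 {m : ℕ} (t : Fin m → ℂ) (p : Fin m → ℝ)
    (ht_alg : ∀ j, IsAlgebraic ℚ (t j)) (ht_inj : Function.Injective t)
    (hp_nonneg : ∀ j, 0 ≤ p j) (hp_sum : ∑ j, p j = 1)
    (h : ℝ) (hh : h < vectorEntropy p) :
    ∃ M : ℝ, 0 < M ∧ ∀ η : ℂ, IsAlgebraic ℚ η → 0 < ‖η‖ → ‖η‖ < 1 → M ≤ algMahlerMeasure η →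
      Filter.Tendsto (fun n : ℕ => partialSumEntropy η (atomicMeasure t p) n / n) Filter.atTop
        (nhds (garsiaEntropy η (atomicMeasure t p))) ∧
      h ≤ garsiaEntropy η (atomicMeasure t p) := by
  obtain ⟨M, hM, hle⟩ :=
    Garsia.exists_mahler_forall_le_ent_partialSum ht_alg ht_inj hp_nonneg hp_sum hh
  refine ⟨M, hM, fun η hη hη0 _ hηM => ?_⟩
  have hη0 : η ≠ 0 := norm_pos_iff.1 hη0
  have hν := Garsia.isNonneg_law t hp_nonneg
  have hν1 := Garsia.mass_law t hp_sum
  have hsub := Garsia.subadditive_ent_partialSum hη0 hν hν1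
  have hbdd : BddBelow (Set.range fun n : ℕ =>
      Garsia.ent (Garsia.partialSum η (Garsia.law t p) n) / n) := by
    refine ⟨0, ?_⟩
    rintro _ ⟨n, rfl⟩
    exact div_nonneg (Garsia.ent_nonneg (hν.partialSum η n) (Garsia.mass_partialSum η hν1 n))
      (Nat.cast_nonneg n)
  have htend : Filter.Tendsto (fun n : ℕ => partialSumEntropy η (atomicMeasure t p) n / n)
      Filter.atTop (nhds hsub.lim) := by
    simp only [Garsia.partialSumEntropy_eq_ent hp_nonneg]
    exact hsub.tendsto_lim hbdd
  have hlim : garsiaEntropy η (atomicMeasure t p) = hsub.lim := htend.limUnder_eq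
  rw [hlim]
  refine ⟨htend, ge_of_tendsto htend ?_⟩
  filter_upwards [Filter.eventually_gt_atTop 0] with n hn
  rw [Garsia.partialSumEntropy_eq_ent hp_nonneg, le_div_iff₀ (by exact_mod_cast hn), mul_comm]
  exact hle η hη hη0 hηM n
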